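/- Let $G$ be a finite simple graph on the vertex set $\{0,\dots,n-1\}$ whose edges are each coloured red or blue. For a set $S$ of edges let $R(S)$ and $B(S)$ be the sets of red and of blue edges in $S$; for a perfect matching $M$ let $r(M)=|R(M)|$; and let $M\,\Delta\,M'$ denote the symmetric difference of the edge sets of $M$ and $M'$. There is one deterministic algorithm which, given the coloured graph $G$, a perfect matching $M$ of $G$, and natural numbers $k$ and $L$, always halts within $n^{O(L)}$ steps and has the following property: whenever $M'$ is a perfect matching of $G$ with $r(M')=k$ and $$|B(M\,\Delta\,M')|\le L\quad\text{or}\quad |R(M\,\Delta\,M')|\le L ,$$ the algorithm outputs a perfect matching $M''$ of $G$ with $r(M'')=r(M')$. (The matching $M'$ itself is not given to the algorithm.) Here $n^{O(L)}$ means at most $\max(n,2)^{c\cdot\max(L,1)}$ for an absolute constant $c$. Steps are counted on a deterministic random access machine with unit-cost memory access, comparison, addition and truncated subtraction (but no unit-cost multiplication) on natural numbers. Graphs and matchings are given as adjacency matrices. -/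

import Mathlib

/-! Deterministic random access machines, presented as structured programs.  The memory consists of
two-dimensional arrays of natural numbers.  Every elementary operation (constant, memory access,
addition, truncated subtraction, assignment, test) costs one step.  There is no unit-cost
multiplication, so numbers grow by at most a constant number of bits per step and the machine is
polynomially equivalent to a Turing machine. -/

namespace RAM

/-- `m a i j` is the content of cell `(i, j)` of array number `a`. -/
abbrev Memory : Type := ℕ → ℕ → ℕ → ℕ

/-- Expressions: constants, memory access with computed indices, sum, truncated difference. -/
inductive Expr : Type
  | lit (c : ℕ) : Expr
  | read (a : ℕ) (i j : Expr) : Expr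
  | add (e f : Expr) : Expr
  | sub (e f : Expr) : Expr

/-- The value of an expression. -/
def Expr.eval (m : Memory) : Expr → ℕ
  | .lit c => c
  | .read a i j => m a (i.eval m) (j.eval m)
  | .add e f => e.eval m + f.eval m
  | .sub e f => e.eval m - f.eval m

/-- The number of elementary operations needed to evaluate an expression. -/
def Expr.cost : Expr → ℕ
  | .lit _ => 1
  | .read _ i j => i.cost + j.cost + 1
  | .add e f => e.cost + f.cost + 1
  | .sub e f => e.cost + f.cost + 1

/-- Programs.  A test succeeds when its expression is nonzero. -/
inductive Prog : Type
  | skip : Prog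
  | assign (a : ℕ) (i j e : Expr) : Prog
  | seq (p q : Prog) : Prog
  | ite (e : Expr) (p q : Prog) : Prog
  | while (e : Expr) (p : Prog) : Prog

/-- Write `v` into cell `(i, j)` of array `a`. -/
def Memory.write (m : Memory) (a i j v : ℕ) : Memory :=
  fun a' i' j' => if a' = a ∧ i' = i ∧ j' = j then v else m a' i' j'

/-- `Runs p m t m'`: started on memory `m`, the program `p` halts after exactly `t` steps
with memory `m'`. -/
inductive Runs : Prog → Memory → ℕ → Memory → Prop
  | skip (m : Memory) : Runs .skip m 1 m
  | assign (a : ℕ) (i j e : Expr) (m : Memory) :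
      Runs (.assign a i j e) m (i.cost + j.cost + e.cost + 1)
        (m.write a (i.eval m) (j.eval m) (e.eval m))
  | seq {p q : Prog} {m₀ m₁ m₂ : Memory} {s t : ℕ} :
      Runs p m₀ s m₁ → Runs q m₁ t m₂ → Runs (.seq p q) m₀ (s + t) m₂
  | iteTrue {e : Expr} {p q : Prog} {m m' : Memory} {t : ℕ} :
      e.eval m ≠ 0 → Runs p m t m' → Runs (.ite e p q) m (e.cost + 1 + t) m'
  | iteFalse {e : Expr} {p q : Prog} {m m' : Memory} {t : ℕ} :
      e.eval m = 0 → Runs q m t m' → Runs (.ite e p q) m (e.cost + 1 + t) m'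
  | whileTrue {e : Expr} {p : Prog} {m₀ m₁ m₂ : Memory} {s t : ℕ} :
      e.eval m₀ ≠ 0 → Runs p m₀ s m₁ → Runs (.while e p) m₁ t m₂ →
      Runs (.while e p) m₀ (e.cost + 1 + s + t) m₂
  | whileFalse {e : Expr} {p : Prog} {m : Memory} :
      e.eval m = 0 → Runs (.while e p) m (e.cost + 1) m

/-- The machine is deterministic: the input determines the running time and the result. -/
theorem Runs.deterministic {p : Prog} {m m₁ m₂ : Memory} {s t : ℕ}
    (h₁ : Runs p m s m₁) (h₂ : Runs p m t m₂) : s = t ∧ m₁ = m₂ := by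
  induction h₁ generalizing t m₂ with
  | skip => cases h₂; exact ⟨rfl, rfl⟩
  | assign => cases h₂; exact ⟨rfl, rfl⟩
  | seq _ _ ih ih' =>
    cases h₂ with
    | seq h h' =>
      obtain ⟨rfl, rfl⟩ := ih h
      obtain ⟨rfl, rfl⟩ := ih' h'
      exact ⟨rfl, rfl⟩
  | iteTrue hc _ ih =>
    cases h₂ with
    | iteTrue _ h => obtain ⟨rfl, rfl⟩ := ih h; exact ⟨rfl, rfl⟩
    | iteFalse hc' _ => exact absurd hc' hc
  | iteFalse hc _ ih =>
    cases h₂ with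
    | iteTrue hc' _ => exact absurd hc hc'
    | iteFalse _ h => obtain ⟨rfl, rfl⟩ := ih h; exact ⟨rfl, rfl⟩
  | whileTrue hc _ _ ih ih' =>
    cases h₂ with
    | whileTrue _ h h' =>
      obtain ⟨rfl, rfl⟩ := ih h
      obtain ⟨rfl, rfl⟩ := ih' h'
      exact ⟨rfl, rfl⟩
    | whileFalse hc' => exact absurd hc' hc
  | whileFalse hc =>
    cases h₂ with
    | whileTrue hc' _ _ => exact absurd hc hc'
    | whileFalse _ => exact ⟨rfl, rfl⟩

end RAM

namespace ExactMatching

/-- The two edge colours. -/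
inductive Color : Type
  | red : Color
  | blue : Color

/-- The edges of colour `x` in the edge set `S`. -/
def ofColor {V : Type*} {G : SimpleGraph V} (C : G.EdgeLabeling Color) (x : Color)
    (S : Set (Sym2 V)) : Set (Sym2 V) :=
  S ∩ (C.labelGraph x).edgeSet

/-- `r(M)`, the number of red edges of `M`. -/
noncomputable def redCount {V : Type*} {G : SimpleGraph V} (C : G.EdgeLabeling Color)
    (M : G.Subgraph) : ℕ :=
  (ofColor C .red M.edgeSet).ncard

open Classical in
/-- The adjacency matrix of a relation on `Fin n`, as the content of an array (zero elsewhere). -/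
noncomputable def matrixArray {n : ℕ} (r : Fin n → Fin n → Prop) (i j : ℕ) : ℕ :=
  if ∃ u v : Fin n, (u : ℕ) = i ∧ (v : ℕ) = j ∧ r u v then 1 else 0

/-- The initial memory for the input `(G, C, M, k, L)`: array `0` holds `n`, `k`, `L` in the cells
`(0, 0)`, `(0, 1)`, `(0, 2)`; arrays `1`, `2`, `3` hold the adjacency matrices of `G`, of the graph
of red edges of `G`, and of `M`; all other cells are zero. -/
noncomputable def inputMemory {n : ℕ} (G : SimpleGraph (Fin n)) (C : G.EdgeLabeling Color)
    (M : G.Subgraph) (k L : ℕ) : RAM.Memory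
  | 0, 0, 0 => n
  | 0, 0, 1 => k
  | 0, 0, 2 => L
  | 1, i, j => matrixArray G.Adj i j
  | 2, i, j => matrixArray (C.labelGraph .red).Adj i j
  | 3, i, j => matrixArray M.Adj i j
  | _, _, _ => 0

/-- The output convention: array `4` holds the adjacency matrix of `M`. -/
def Outputs {n : ℕ} {G : SimpleGraph (Fin n)} (m : RAM.Memory) (M : G.Subgraph) : Prop :=
  ∀ u v : Fin n, m 4 u v = matrixArray M.Adj u v

end ExactMatching

/-!
Suppose that `M Δ M'` has at most `L` edges of colour `c`.  These are given by `2 * L` base `n`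
digits, so all `n ^ (2 * L)` guesses for them can be tried, for both colours.  A correct guess
determines the edges of colour `c` in `M'`.  Every perfect matching of the graph consisting of these
edges and of the edges of the other colour which do not meet them has the same edges of colour `c`
as `M'`, hence also the same number of red edges, because all perfect matchings have the same size.
So it suffices to find any perfect matching of that graph.

Edmonds' blossom search needs to handle only matchings with exactly two exposed vertices, and only
to decide whether a perfect matching exists.  If the alternating forest cannot be extended, it has
more outer blossoms, all of them odd and with inner neighbours only, than inner vertices, so there
is no perfect matching.  If an edge joins two outer blossoms, one climbs from both of them towards
the roots: either the climbs meet, and what they have passed is shrunk into a factor critical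
blossom, or they end in the two exposed vertices, and there is a perfect matching.

The decision procedure suffices to find a perfect matching of a graph `T`.  Start from `M`, as a
perfect matching of the complete graph, and treat the vertices one after the other: at the vertex
`r`, remove the edge of the matching, and add the edges of `T` to those of the matching.  If `T`
has a perfect matching, so does the resulting graph.  Delete those of its edges outside the
matching without which there still is a perfect matching.  The remaining edges outside the matching
are in every perfect matching, so that the perfect matching can be read off.  It uses an edge of
`T` at `r`, because there are no other edges at `r`, and at all vertices treated before.
-/

namespace ExactMatching

section Matchable

variable {V : Type*} {H : SimpleGraph V} {f : V → V} {S T : Set V}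

/-- The map `f` is a perfect matching of the vertex set `S` by edges of `H`: every vertex of `S` is
sent to its partner.  Outside `S` the map is arbitrary. -/
def IsPairing (H : SimpleGraph V) (f : V → V) (S : Set V) : Prop :=
  ∀ x ∈ S, f x ∈ S ∧ f (f x) = x ∧ H.Adj x (f x)

/-- The vertex set `S` has a perfect matching by edges of `H`. -/
def Matchable (H : SimpleGraph V) (S : Set V) : Prop :=
  ∃ f, IsPairing H f S

theorem Matchable.empty : Matchable H ∅ :=
  ⟨id, fun _ hx => hx.elim⟩

theorem Matchable.union (hS : Matchable H S) (hT : Matchable H T) (hST : Disjoint S T) :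
    Matchable H (S ∪ T) := by
  classical
  obtain ⟨f, hf⟩ := hS
  obtain ⟨g, hg⟩ := hT
  refine ⟨fun x => if x ∈ S then f x else g x, ?_⟩
  rintro x (hx | hx)
  · simp [hf x hx, hx]
  · have hxS : x ∉ S := hST.notMem_of_mem_right hx
    have hgx : g x ∉ S := hST.notMem_of_mem_right (hg x hx).1
    simp [hg x hx, hxS, hgx]

theorem Matchable.pair {x y : V} (h : H.Adj x y) : Matchable H {x, y} := by
  classical
  refine ⟨fun z => if z = x then y else x, ?_⟩
  rintro z (rfl | rfl)
  · simp [h, h.ne']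
  · simp [h.symm, h.ne']

theorem Matchable.mono {H' : SimpleGraph V} (h : Matchable H S) (hH : H ≤ H') : Matchable H' S :=
  h.imp fun _ hf x hx => ⟨(hf x hx).1, (hf x hx).2.1, hH (hf x hx).2.2⟩

theorem IsPairing.even_ncard [Finite V] (h : IsPairing H f S) : Even S.ncard := by
  classical
  have := Fintype.ofFinite V
  have hsum : ∑ _ ∈ S.toFinset, (1 : ZMod 2) = 0 :=
    Finset.sum_involution (fun x _ => f x) (fun _ _ => by decide)
      (fun x hx _ => (h x (by simpa using hx)).2.2.ne')
      (fun x hx => by simpa using (h x (by simpa using hx)).1)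
      (fun x hx => (h x (by simpa using hx)).2.1)
  rw [Set.ncard_eq_toFinset_card', ← ZMod.natCast_eq_zero_iff_even]
  simpa using hsum

/-- The vertex `y` and the factor critical set `K` lie between the set `P` and the vertex `p'`:
there are edges from `a ∈ K` to `y` and from `y` to `p'`. -/
structure IsLink (H : SimpleGraph V) (P K : Set V) (a y p' : V) : Prop where
  critical : ∀ x ∈ K, Matchable H (K \ {x})
  mem : a ∈ K
  adj_left : H.Adj a y
  adj_right : H.Adj y p'
  disjoint : ∀ x ∈ K, x ∉ P
  notMem_link : y ∉ P ∪ K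
  notMem : p' ∉ P ∪ K

namespace IsLink

variable {P K : Set V} {a p p' q y : V}

theorem matchable_union_pair (h : IsLink H P K a y p') (hp : p ∈ K) (hq : q ∉ insert y (P ∪ K))
    (hpq : Matchable H (P ∪ {p, q})) (hne : p' ≠ q) :
    Matchable H (insert y (P ∪ K) ∪ {p', q}) := by
  have := h.disjoint; have := h.notMem_link; have := h.notMem; have := h.adj_right.ne
  have hset : insert y (P ∪ K) ∪ {p', q} = P ∪ {p, q} ∪ K \ {p} ∪ {y, p'} := by
    ext; grind
  rw [hset]
  refine (hpq.union (h.critical p hp) ?_).union (.pair h.adj_right) ?_ <;>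
    rw [Set.disjoint_left] <;> grind

theorem matchable_sdiff (h : IsLink H P K a y p') (hp : p ∈ K) (hq : q ∉ insert y (P ∪ K))
    (hP : Matchable H P) (hpq : Matchable H (P ∪ {p, q}))
    (hsdiff : ∀ x ∈ P, Matchable H ((P ∪ {p}) \ {x}) ∨ Matchable H ((P ∪ {q}) \ {x})) :
    ∀ x ∈ insert y (P ∪ K), Matchable H ((insert y (P ∪ K) ∪ {p'}) \ {x}) ∨
      Matchable H ((insert y (P ∪ K) ∪ {q}) \ {x}) := by
  have hd := h.disjoint; have hyn := h.notMem_link; have hp' := h.notMem; have := h.adj_right.ne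
  have ha := h.mem
  rintro x (rfl | hx | hx)
  · right
    have hset : (insert x (P ∪ K) ∪ {q}) \ {x} = P ∪ {p, q} ∪ K \ {p} := by
      ext; grind
    rw [hset]
    refine hpq.union (h.critical p hp) ?_
    rw [Set.disjoint_left]; grind
  · rcases hsdiff x hx with hm | hm
    · left
      have hset : (insert y (P ∪ K) ∪ {p'}) \ {x} = (P ∪ {p}) \ {x} ∪ K \ {p} ∪ {y, p'} := by
        ext; grind
      rw [hset]
      refine (hm.union (h.critical p hp) ?_).union (.pair h.adj_right) ?_ <;>
        rw [Set.disjoint_left] <;> grind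
    · right
      have hset : (insert y (P ∪ K) ∪ {q}) \ {x} = (P ∪ {q}) \ {x} ∪ K \ {a} ∪ {a, y} := by
        ext; grind
      rw [hset]
      refine (hm.union (h.critical a ha) ?_).union (.pair h.adj_left) ?_ <;>
        rw [Set.disjoint_left] <;> grind
  · left
    have hset : (insert y (P ∪ K) ∪ {p'}) \ {x} = P ∪ K \ {x} ∪ {y, p'} := by
      ext; grind
    rw [hset]
    refine (hP.union (h.critical x hx) ?_).union (.pair h.adj_right) ?_ <;>
      rw [Set.disjoint_left] <;> grind

end IsLink

end Matchable

section BlossomForest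

variable {V : Type*}

/-- `N` sends every vertex covered by a matching of `H` to its partner and fixes the exposed
vertices. -/
structure IsMate (H : SimpleGraph V) (N : V → V) : Prop where
  mate_mate : ∀ x, N (N x) = x
  adj : ∀ x, N x ≠ x → H.Adj x (N x)

theorem IsMate.isPairing {H : SimpleGraph V} {N : V → V} (hN : IsMate H N) {S : Set V}
    (hS : ∀ x ∈ S, N x ∈ S ∧ N x ≠ x) : IsPairing H N S :=
  fun x hx => ⟨(hS x hx).1, hN.mate_mate x, hN.adj x (hS x hx).2⟩

/-- The state of Edmonds' search for augmenting paths: the outer and inner vertices, the base of the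
blossom of each vertex (a vertex in no blossom is its own base), the parents of the inner vertices,
and the depth of the outer bases. -/
structure Forest (V : Type*) where
  outer : Set V
  inner : Set V
  base : V → V
  parent : V → V
  rank : V → ℕ

namespace Forest

variable {H : SimpleGraph V} {N : V → V} {F : Forest V} {Q : Set V} {a b u v x : V}

/-- The blossom with base `b`. -/
def blossom (F : Forest V) (b : V) : Set V :=
  F.base ⁻¹' {b}

/-- The invariants of an alternating forest of the matching `N`, rooted at the exposed vertices,
whose blossoms are factor critical. -/
structure IsAlternating (H : SimpleGraph V) (N : V → V) (F : Forest V) : Prop where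
  notMem_inner : ∀ x ∈ F.outer, x ∉ F.inner
  root : ∀ x, N x = x → x ∈ F.outer ∧ F.base x = x ∧ F.rank x = 0
  base_base : ∀ x, F.base (F.base x) = F.base x
  base_mem : ∀ x ∈ F.outer, F.base x ∈ F.outer
  base_of_notMem : ∀ x ∉ F.outer, F.base x = x
  mate_base : ∀ b ∈ F.outer, F.base b = b → N b ≠ b → N b ∈ F.inner
  mate_inner : ∀ y ∈ F.inner, N y ∈ F.outer ∧ F.base (N y) = N y
  parent_inner : ∀ y ∈ F.inner, F.parent y ∈ F.outer ∧ H.Adj y (F.parent y) ∧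
    F.rank (F.base (F.parent y)) < F.rank (N y)
  mate_of_base_ne : ∀ x ∈ F.outer, F.base x ≠ x → N x ∈ F.outer ∧ F.base (N x) = F.base x
  critical : ∀ x ∈ F.outer, Matchable H (F.blossom (F.base x) \ {x})

/-- The forest consisting of the exposed vertices only. -/
def init (N : V → V) : Forest V where
  outer := {x | N x = x}
  inner := ∅
  base := id
  parent := id
  rank := 0

theorem isAlternating_init (H : SimpleGraph V) (N : V → V) : (init N).IsAlternating H N where
  notMem_inner _ _ := id
  root _ h := ⟨h, rfl, rfl⟩
  base_base _ := rfl
  base_mem _ h := h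
  base_of_notMem _ _ := rfl
  mate_base _ h _ hne := absurd h hne
  mate_inner _ h := h.elim
  parent_inner _ h := h.elim
  mate_of_base_ne _ _ h := absurd rfl h
  critical x _ := by
    have hempty : (init N).blossom ((init N).base x) \ {x} = ∅ := by
      ext y
      simp [blossom, init]
    rw [hempty]
    exact .empty

open Classical in
/-- The forest after the edge from the outer vertex `u` to the unvisited vertex `v`, and the
matching edge at `v`, have been added. -/
noncomputable def grow (F : Forest V) (N : V → V) (u v : V) : Forest V where
  outer := insert (N v) F.outer
  inner := insert v F.inner
  base := F.base
  parent := Function.update F.parent v u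
  rank := Function.update F.rank (N v) (F.rank (F.base u) + 1)

open Classical in
/-- The forest after all blossoms and inner vertices in `F.base ⁻¹' Q` have been shrunk into the
blossom with base `a`. -/
noncomputable def shrink (F : Forest V) (a : V) (Q : Set V) : Forest V where
  outer := F.outer ∪ F.base ⁻¹' Q
  inner := F.inner \ F.base ⁻¹' Q
  base x := if F.base x ∈ Q then a else F.base x
  parent := F.parent
  rank := F.rank

namespace IsAlternating

theorem blossom_of_inner (hF : F.IsAlternating H N) (hv : v ∈ F.inner) :
    F.base x = v ↔ x = v := by
  have h1 := hF.notMem_inner; have h2 := hF.base_mem x; have h3 := hF.base_of_notMem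
  grind

theorem mate_notMem (hF : F.IsAlternating H N) (hN : IsMate H N) (hv : v ∉ F.outer)
    (hv' : v ∉ F.inner) : N v ∉ F.outer ∧ N v ∉ F.inner := by
  have := hN.mate_mate v
  refine ⟨fun h => ?_, fun h => hv (this ▸ (hF.mate_inner _ h).1)⟩
  by_cases hb : F.base (N v) = N v
  · have := hF.mate_base _ h hb
    have := hF.root v
    grind
  · have := hF.mate_of_base_ne _ h hb
    grind

theorem grow (hF : F.IsAlternating H N) (hN : IsMate H N) (hu : u ∈ F.outer) (huv : H.Adj u v)
    (hv : v ∉ F.outer) (hv' : v ∉ F.inner) : (F.grow N u v).IsAlternating H N := by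
  obtain ⟨hw, hw'⟩ := hF.mate_notMem hN hv hv'
  have hwv := hN.mate_mate v
  have hbase_ne : ∀ x ∈ F.outer, F.base x ≠ N v := fun x hx h => hw (h ▸ hF.base_mem x hx)
  have hne : N v ≠ v := fun h => hv (hF.root v h).1
  have hbw := hF.base_of_notMem _ hw
  constructor <;> simp only [Forest.grow, Set.mem_insert_iff, forall_eq_or_imp]
  · have := hF.notMem_inner
    grind
  · have := hF.root
    grind
  · exact hF.base_base
  · have := hF.base_mem
    grind
  · have := hF.base_of_notMem
    grind
  · have := hF.mate_base
    grind
  · have := hF.mate_inner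
    grind
  · have := hF.parent_inner
    have := hN.mate_mate
    grind [huv.symm]
  · have := hF.mate_of_base_ne
    grind
  · have hempty : F.blossom (F.base (N v)) \ {N v} = ∅ := by
      ext x
      have := hbase_ne x
      have := hF.base_of_notMem x
      simp only [blossom, Set.mem_sdiff, Set.mem_preimage, Set.mem_singleton_iff]
      grind
    refine ⟨?_, hF.critical⟩
    change Matchable H (F.blossom (F.base (N v)) \ {N v})
    rw [hempty]
    exact .empty

end IsAlternating

/-- The outer vertex `u` has a neighbour `v` which is unvisited or outer in another blossom. -/
def IsActive (H : SimpleGraph V) (F : Forest V) (u v : V) : Prop :=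
  u ∈ F.outer ∧ H.Adj u v ∧ v ∉ F.inner ∧ F.base u ≠ F.base v

/-- `b` is the base of an outer blossom, possibly of a trivial one. -/
def IsBase (F : Forest V) (b : V) : Prop :=
  b ∈ F.outer ∧ F.base b = b

namespace IsAlternating

theorem mate_eq_of_rank_eq_zero (hF : F.IsAlternating H N) (hN : IsMate H N) {b : V}
    (hb : F.IsBase b) (hrank : F.rank b = 0) : N b = b := by
  by_contra hne
  have := (hF.parent_inner _ (hF.mate_base b hb.1 hb.2 hne)).2.2
  simp [hN.mate_mate, hrank] at this

theorem odd_ncard_blossom [Finite V] (hF : F.IsAlternating H N) (hb : F.IsBase b) :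
    Odd (F.blossom b).ncard := by
  obtain ⟨f, hf⟩ := hF.critical b hb.1
  rw [hb.2] at hf
  have hmem : b ∈ F.blossom b := hb.2
  rw [← Set.ncard_sdiff_singleton_add_one hmem]
  exact hf.even_ncard.add_one

/-- Odd blossoms whose outside neighbours are all inner force every perfect matching to match
distinct inner vertices into distinct blossoms, but there are more bases than inner vertices. -/
theorem not_matchable_of_forall_not_isActive [Finite V] (hF : F.IsAlternating H N)
    (hN : IsMate H N) {r : V} (hr : N r = r) (hstuck : ∀ u v, ¬ IsActive H F u v) :
    ¬ Matchable H Set.univ := by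
  rintro ⟨f, hf⟩
  have hexit : ∀ b ∈ {b | F.IsBase b}, ∃ x, F.base x = b ∧ f x ∈ F.inner := by
    intro b hb
    by_contra! h
    refine Nat.not_even_iff_odd.2 (hF.odd_ncard_blossom hb)
      (IsPairing.even_ncard (H := H) (f := f) fun x hx => ⟨?_, (hf x trivial).2⟩)
    have hxb : F.base x = b := hx
    have hx' : x ∈ F.outer := by
      have := hF.base_of_notMem x
      grind [IsBase]
    have := hstuck x (f x)
    have := h x hxb
    have := (hf x trivial).2.2
    grind [IsActive, blossom]
  choose! g hg hg' using hexit
  have hle : {b | F.IsBase b}.ncard ≤ F.inner.ncard := by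
    refine Set.ncard_le_ncard_of_injOn (fun b => f (g b)) hg' ?_
    intro b hb b' hb' h
    have := congrArg f h
    simp only [(hf _ trivial).2.1] at this
    rw [← hg b hb, this, hg b' hb']
  have hlt : F.inner.ncard < {b | F.IsBase b}.ncard := by
    rw [← Set.ncard_image_of_injective F.inner (Function.LeftInverse.injective hN.mate_mate)]
    refine Set.ncard_lt_ncard ⟨?_, fun h => ?_⟩
    · rintro _ ⟨y, hy, rfl⟩
      exact hF.mate_inner y hy
    · obtain ⟨y, hy, hyr⟩ := h (show F.IsBase r from ⟨(hF.root r hr).1, (hF.root r hr).2.1⟩)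
      have := hN.mate_mate y
      have := hF.notMem_inner r (hF.root r hr).1
      grind
  omega

end IsAlternating

/-- The state of the simultaneous climb from two adjacent outer blossoms towards the roots.  The
climb has reached the bases `a` and `b`, and `F.base ⁻¹' Q` is the set of vertices passed so far; it
is a path of blossoms and inner vertices whose ends are joined to some `p` in the blossom of `a` and
some `q` in the blossom of `b`. -/
structure IsClimb (H : SimpleGraph V) (N : V → V) (F : Forest V) (a b : V) (Q : Set V) : Prop where
  isBase_left : F.IsBase a
  isBase_right : F.IsBase b
  left_notMem : a ∉ Q
  right_notMem : b ∉ Q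
  mate_mem : ∀ x, F.base x ∈ Q → F.base (N x) ∈ Q ∧ N x ≠ x
  rank_le : ∀ x, F.IsBase x → x ∈ Q → F.rank a ≤ F.rank x ∧ F.rank b ≤ F.rank x
  matchable : ∃ p q, p ∈ F.outer ∧ F.base p = a ∧ q ∈ F.outer ∧ F.base q = b ∧
    (a ≠ b → Matchable H (F.base ⁻¹' Q ∪ {p, q})) ∧
    ∀ x ∈ F.base ⁻¹' Q, Matchable H ((F.base ⁻¹' Q ∪ {p}) \ {x}) ∨
      Matchable H ((F.base ⁻¹' Q ∪ {q}) \ {x})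
  exists_inner : a = b → ∃ y ∈ F.inner, F.base y ∈ Q

namespace IsClimb

theorem start (hF : F.IsAlternating H N) (hu : u ∈ F.outer) (hv : v ∈ F.outer) (huv : H.Adj u v)
    (hne : F.base u ≠ F.base v) :
    F.IsClimb H N (F.base u) (F.base v) ∅ where
  isBase_left := ⟨hF.base_mem u hu, hF.base_base u⟩
  isBase_right := ⟨hF.base_mem v hv, hF.base_base v⟩
  left_notMem := id
  right_notMem := id
  mate_mem _ h := h.elim
  rank_le _ _ h := h.elim
  matchable := ⟨u, v, hu, rfl, hv, rfl, fun _ => by simpa using .pair huv, fun _ h => h.elim⟩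
  exists_inner h := absurd h hne

theorem symm (h : F.IsClimb H N a b Q) : F.IsClimb H N b a Q where
  isBase_left := h.isBase_right
  isBase_right := h.isBase_left
  left_notMem := h.right_notMem
  right_notMem := h.left_notMem
  mate_mem := h.mate_mem
  rank_le x hx hxQ := (h.rank_le x hx hxQ).symm
  matchable := by
    obtain ⟨p, q, hp, hpa, hq, hqb, hpq, hx⟩ := h.matchable
    exact ⟨q, p, hq, hqb, hp, hpa, fun hne => Set.pair_comm p q ▸ hpq hne.symm,
      fun x hxQ => (hx x hxQ).symm⟩
  exists_inner hba := h.exists_inner hba.symm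

theorem matchable_passed (hN : IsMate H N) (h : F.IsClimb H N a b Q) :
    Matchable H (F.base ⁻¹' Q) :=
  ⟨N, hN.isPairing h.mate_mem⟩

theorem notMem_mate_left (hN : IsMate H N) (h : F.IsClimb H N a b Q) (hy : N a ∈ F.inner)
    (hF : F.IsAlternating H N) : N a ∉ Q := by
  intro hyQ
  have hbase := (hF.blossom_of_inner hy).2 rfl
  have hNa := hN.mate_mate a
  have := h.mate_mem (N a) (hbase.symm ▸ hyQ)
  grind [h.isBase_left.2, h.left_notMem]

theorem preimage_insert (hF : F.IsAlternating H N) (hy : N a ∈ F.inner) :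
    F.base ⁻¹' insert a (insert (N a) Q) = insert (N a) (F.base ⁻¹' Q ∪ F.blossom a) := by
  ext x
  have := hF.blossom_of_inner (x := x) hy
  simp only [blossom, Set.mem_preimage, Set.mem_insert_iff, Set.mem_union, Set.mem_singleton_iff]
  tauto

theorem isLink (hF : F.IsAlternating H N) (hN : IsMate H N) (h : F.IsClimb H N a b Q)
    (ha : N a ≠ a) : IsLink H (F.base ⁻¹' Q) (F.blossom a) a (N a) (F.parent (N a)) := by
  have hy : N a ∈ F.inner := hF.mate_base a h.isBase_left.1 h.isBase_left.2 ha
  obtain ⟨hp', hadj, hlt⟩ := hF.parent_inner _ hy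
  rw [hN.mate_mate] at hlt
  have hba := h.isBase_left
  have hrk := h.rank_le _ ⟨hF.base_mem _ hp', hF.base_base _⟩
  have hmem : ∀ x, x ∈ F.blossom a ↔ F.base x = a := fun x => Iff.rfl
  refine ⟨fun x hx => ?_, hba.2, hN.adj a ha, hadj, fun x hx => ?_, ?_, ?_⟩
  · rw [← hx]
    refine hF.critical x (by_contra fun hout => hout ?_)
    rw [← hF.base_of_notMem x hout, hx]
    exact hba.1
  · rw [Set.mem_preimage, hx]
    exact h.left_notMem
  · have := h.notMem_mate_left hN hy hF
    have := hF.notMem_inner a hba.1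
    grind [hF.blossom_of_inner (x := N a) hy]
  · have := hF.notMem_inner _ hp'
    grind

theorem step (hF : F.IsAlternating H N) (hN : IsMate H N) (h : F.IsClimb H N a b Q)
    (hab : a ≠ b) (hrank : F.rank b ≤ F.rank a) (ha : N a ≠ a) :
    F.IsClimb H N (F.base (F.parent (N a))) b (insert a (insert (N a) Q)) := by
  have hy : N a ∈ F.inner := hF.mate_base a h.isBase_left.1 h.isBase_left.2 ha
  have hbase_y : ∀ x, F.base x = N a ↔ x = N a := fun x => hF.blossom_of_inner hy
  obtain ⟨hp', -, hlt⟩ := hF.parent_inner _ hy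
  rw [hN.mate_mate] at hlt
  have hNa := hN.mate_mate a
  have hout := hF.notMem_inner
  have hba := h.isBase_left
  have hbb := h.isBase_right
  have hbQ := h.right_notMem
  have hset := preimage_insert (Q := Q) hF hy
  have hlink := h.isLink hF hN ha
  have ha' : F.IsBase (F.base (F.parent (N a))) := ⟨hF.base_mem _ hp', hF.base_base _⟩
  obtain ⟨p, q, -, hpa, hq, hqb, hpq, hsdiff⟩ := h.matchable
  have hq' : q ∉ insert (N a) (F.base ⁻¹' Q ∪ F.blossom a) := by
    rw [← hset, Set.mem_preimage]
    grind [IsBase]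
  refine ⟨ha', hbb, ?_, ?_, ?_, ?_, ⟨F.parent (N a), q, hp', rfl, hq, hqb, ?_, ?_⟩, fun _ =>
    ⟨N a, hy, by simp [(hbase_y _).2 rfl]⟩⟩
  · have := h.rank_le _ ha'
    grind [IsBase]
  · grind [IsBase]
  · intro x hx
    have := hF.mate_of_base_ne x
    have := hF.base_of_notMem x
    have := h.mate_mem x
    have := hF.root x
    have := hbase_y x
    have := hbase_y (N a)
    simp only [Set.mem_insert_iff] at hx ⊢
    by_cases hxa : x = a <;> grind [IsBase]
  · intro x hx
    have := h.rank_le x hx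
    grind [IsBase]
  · rw [hset]
    exact fun hne => hlink.matchable_union_pair hpa hq' (hpq hab) (by grind)
  · rw [hset]
    exact hlink.matchable_sdiff hpa hq' (h.matchable_passed hN) (hpq hab) hsdiff

theorem matchable_shrunk_sdiff (hF : F.IsAlternating H N) (hN : IsMate H N)
    (h : F.IsClimb H N a a Q) (hx : x ∈ F.outer ∨ F.base x ∈ Q)
    (hxQ : x ∈ F.base ⁻¹' Q ∪ F.blossom a) :
    Matchable H ((F.base ⁻¹' Q ∪ F.blossom a) \ {x}) := by
  have haQ := h.left_notMem
  obtain ⟨p, q, hp, hpa, hq, hqb, -, hsdiff⟩ := h.matchable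
  by_cases hxQ' : F.base x ∈ Q
  · have hcritical : ∀ r ∈ F.outer, F.base r = a →
        Matchable H ((F.base ⁻¹' Q ∪ {r}) \ {x}) →
        Matchable H ((F.base ⁻¹' Q ∪ F.blossom a) \ {x}) := by
      intro r hr hra hm
      have hset : (F.base ⁻¹' Q ∪ F.blossom a) \ {x} =
          (F.base ⁻¹' Q ∪ {r}) \ {x} ∪ F.blossom a \ {r} := by
        ext y
        grind [blossom]
      rw [hset]
      refine hm.union (hra ▸ hF.critical r hr) ?_
      rw [Set.disjoint_left]
      grind [blossom]
    exact (hsdiff x hxQ').elim (hcritical p hp hpa) (hcritical q hq hqb)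
  · have hxa : F.base x = a := hxQ.resolve_left hxQ'
    have hset : (F.base ⁻¹' Q ∪ F.blossom a) \ {x} = F.base ⁻¹' Q ∪ F.blossom a \ {x} := by
      ext y
      grind
    rw [hset]
    refine (h.matchable_passed hN).union (hxa ▸ hF.critical x (hx.resolve_right hxQ')) ?_
    rw [Set.disjoint_left]
    grind [blossom]

theorem matchable_blossom_shrink (hF : F.IsAlternating H N) (hN : IsMate H N)
    (h : F.IsClimb H N a a Q) (hx : x ∈ (F.shrink a Q).outer) :
    Matchable H ((F.shrink a Q).blossom ((F.shrink a Q).base x) \ {x}) := by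
  have haQ := h.left_notMem
  by_cases hxQ : x ∈ F.base ⁻¹' Q ∪ F.blossom a
  · have hset : (F.shrink a Q).blossom ((F.shrink a Q).base x) = F.base ⁻¹' Q ∪ F.blossom a := by
      ext y
      grind [blossom, Forest.shrink]
    rw [hset]
    exact h.matchable_shrunk_sdiff hF hN hx hxQ
  · have hset : (F.shrink a Q).blossom ((F.shrink a Q).base x) = F.blossom (F.base x) := by
      ext y
      grind [blossom, Forest.shrink]
    rw [hset]
    exact hF.critical x (hx.resolve_right fun h => hxQ (.inl h))

theorem shrink (hF : F.IsAlternating H N) (hN : IsMate H N) (h : F.IsClimb H N a a Q) :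
    (F.shrink a Q).IsAlternating H N := by
  have hba := h.isBase_left
  have haQ := h.left_notMem
  have hmate := h.mate_mem
  have hNN := hN.mate_mate
  have hroot := hF.root
  have hbb := hF.base_base
  constructor <;> simp only [Forest.shrink, Set.mem_union, Set.mem_sdiff, Set.mem_preimage]
  · have := hF.notMem_inner
    grind
  · grind
  · grind [IsBase]
  · have := hF.base_mem
    grind [IsBase]
  · have := hF.base_of_notMem
    grind
  · have := hF.mate_base
    grind [IsBase]
  · have := hF.mate_inner
    grind
  · rintro y ⟨hy, -⟩
    obtain ⟨hout, hadj, hlt⟩ := hF.parent_inner y hy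
    refine ⟨.inl hout, hadj, lt_of_le_of_lt ?_ hlt⟩
    split_ifs with hyQ
    · exact (h.rank_le _ ⟨hF.base_mem _ hout, hbb _⟩ hyQ).1
    · exact le_rfl
  · have := hF.mate_of_base_ne
    grind [IsBase]
  · exact fun x hx => h.matchable_blossom_shrink hF hN hx

theorem matchable_univ (hF : F.IsAlternating H N) (hN : IsMate H N) (h : F.IsClimb H N a b Q)
    (hab : a ≠ b) (hroot : ∀ x, N x = x ↔ x = a ∨ x = b) : Matchable H Set.univ := by
  obtain ⟨p, q, hp, hpa, hq, hqb, hpq, -⟩ := h.matchable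
  have hmate := h.mate_mem
  have haQ := h.left_notMem
  have hbQ := h.right_notMem
  set R := (F.base ⁻¹' Q ∪ F.blossom a ∪ F.blossom b)ᶜ
  have hrest : Matchable H R := by
    refine ⟨N, hN.isPairing fun x hx => ?_⟩
    have := hF.mate_of_base_ne x
    have := hF.mate_of_base_ne (N x)
    have := hF.base_of_notMem x
    have := hF.base_of_notMem (N x)
    have := hN.mate_mate x
    have := hmate (N x)
    have := h.isBase_left
    have := h.isBase_right
    grind [IsBase, blossom]
  have hset : Set.univ = F.base ⁻¹' Q ∪ {p, q} ∪ F.blossom a \ {p} ∪ F.blossom b \ {q} ∪ R := by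
    ext x
    grind [blossom]
  rw [hset]
  refine (((hpq hab).union (hpa ▸ hF.critical p hp) ?_).union (hqb ▸ hF.critical q hq) ?_).union
    hrest ?_ <;> rw [Set.disjoint_left] <;> grind [blossom]

end IsClimb

end Forest
end BlossomForest

section Sweep

variable {V : Type*} {H H' T : SimpleGraph V} {N f : V → V} {S : Set (V × V)} {x y r : V}

theorem IsMate.deleteEdges (hN : IsMate H N) (hne : N x ≠ y) :
    IsMate (H.deleteEdges {s(x, y)}) N where
  mate_mate := hN.mate_mate
  adj z hz := by
    have := hN.mate_mate z
    have := hN.adj z hz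
    simp only [SimpleGraph.deleteEdges_adj, Set.mem_singleton_iff, Sym2.eq_iff]
    grind

/-- The state of the edge-by-edge thinning of `H` to a subgraph `H'` which still has the matching
`N` and a perfect matching, after the pairs in `S` have been treated: a treated edge outside `N`
that has survived belongs to every perfect matching of `H'`. -/
structure IsSwept (H : SimpleGraph V) (N : V → V) (S : Set (V × V)) (H' : SimpleGraph V) :
    Prop where
  le : H' ≤ H
  isMate : IsMate H' N
  matchable : Matchable H' Set.univ
  forced : ∀ x y, (x, y) ∈ S → H'.Adj x y → N x ≠ y → ∀ f, IsPairing H' f Set.univ → f x = y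

namespace IsSwept

theorem start (hN : IsMate H N) (hH : Matchable H Set.univ) : IsSwept H N ∅ H where
  le := le_rfl
  isMate := hN
  matchable := hH
  forced _ _ h := h.elim

theorem keep (h : IsSwept H N S H')
    (hxy : H'.Adj x y → N x ≠ y → ¬ Matchable (H'.deleteEdges {s(x, y)}) Set.univ) :
    IsSwept H N (insert (x, y) S) H' := by
  refine ⟨h.le, h.isMate, h.matchable, ?_⟩
  rintro x' y' (hxy' | hxy') hadj hne f hf
  · obtain ⟨rfl, rfl⟩ := Prod.mk.inj hxy'
    by_contra hfx
    refine hxy hadj hne ⟨f, fun z hz => ⟨hz, (hf z hz).2.1, ?_⟩⟩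
    have hfz := hf z hz
    simp only [SimpleGraph.deleteEdges_adj, Set.mem_singleton_iff, Sym2.eq_iff]
    grind
  · exact h.forced x' y' hxy' hadj hne f hf

theorem delete (h : IsSwept H N S H') (hne : N x ≠ y)
    (hxy : Matchable (H'.deleteEdges {s(x, y)}) Set.univ) :
    IsSwept H N (insert (x, y) S) (H'.deleteEdges {s(x, y)}) := by
  have hle : H'.deleteEdges {s(x, y)} ≤ H' := SimpleGraph.deleteEdges_le _
  refine ⟨hle.trans h.le, h.isMate.deleteEdges hne, hxy, fun x' y' hxy' hadj hne' f hf => ?_⟩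
  simp only [SimpleGraph.deleteEdges_adj, Set.mem_singleton_iff] at hadj
  refine h.forced x' y' ?_ hadj.1 hne' f fun z hz => ⟨hz, (hf z hz).2.1, hle (hf z hz).2.2⟩
  grind

theorem exists_isPairing (h : IsSwept H N Set.univ H') : ∃ f, IsPairing H f Set.univ ∧
    ∀ x, (∀ y, H'.Adj x y → N x ≠ y → f x = y) ∧ ((∀ y, H'.Adj x y → N x = y) → f x = N x) := by
  obtain ⟨f, hf⟩ := h.matchable
  refine ⟨f, fun x hx => ⟨hx, (hf x hx).2.1, h.le (hf x hx).2.2⟩, fun x => ⟨fun y hadj hne =>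
    h.forced x y trivial hadj hne f hf, fun hx => (hx _ (hf x trivial).2.2).symm⟩⟩

end IsSwept

open Classical in
/-- The matching without its edge at `r`. -/
noncomputable def exposing (N : V → V) (r x : V) : V :=
  if x = r ∨ x = N r then x else N x

/-- The graph in which a matching is turned into one that uses an edge of `T` at `r`: the edges of
`T` together with the edges of the matching outside `r`. -/
noncomputable def exchangeGraph (T : SimpleGraph V) (N : V → V) (r : V) : SimpleGraph V :=
  T ⊔ SimpleGraph.fromRel fun x y => exposing N r x = y

theorem exchangeGraph_adj : (exchangeGraph T N r).Adj x y ↔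
    T.Adj x y ∨ x ≠ y ∧ (exposing N r x = y ∨ exposing N r y = x) := by
  rw [exchangeGraph, SimpleGraph.sup_adj, SimpleGraph.fromRel_adj]

theorem exposing_eq_self_iff (hN : ∀ x, N x ≠ x) : exposing N r x = x ↔ x = r ∨ x = N r := by
  grind [exposing]

theorem isMate_exposing (hNN : ∀ x, N (N x) = x) :
    IsMate (exchangeGraph T N r) (exposing N r) where
  mate_mate x := by
    have := hNN x
    grind [exposing]
  adj x hx := exchangeGraph_adj.2 (.inr ⟨hx.symm, .inl rfl⟩)

theorem adj_of_isPairing_exchangeGraph (hNN : ∀ x, N (N x) = x)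
    (hf : IsPairing (exchangeGraph T N r) f Set.univ) (hx : x = r ∨ T.Adj x (N x)) :
    T.Adj x (f x) := by
  have hadj := exchangeGraph_adj.1 (hf x trivial).2.2
  have := (isMate_exposing (T := T) (r := r) hNN).mate_mate x
  have := (isMate_exposing (T := T) (r := r) hNN).mate_mate (f x)
  grind [exposing]

theorem matchable_exchangeGraph (hT : Matchable T Set.univ) :
    Matchable (exchangeGraph T N r) Set.univ :=
  hT.mono le_sup_left

end Sweep

section Completion

variable {V : Type*} {G K F : SimpleGraph V} {f g : V → V}

/-- The graph whose perfect matchings are the perfect matchings of `G` with the set `F` of edges in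
the subgraph `K`. -/
def completion (G K F : SimpleGraph V) : SimpleGraph V where
  Adj x y := F.Adj x y ∨ G.Adj x y ∧ ¬ K.Adj x y ∧ (∀ z, ¬ F.Adj x z) ∧ ∀ z, ¬ F.Adj y z
  symm := ⟨fun x y h => by simpa only [SimpleGraph.adj_comm, and_comm] using h⟩
  loopless := ⟨fun x h => by simp at h⟩

theorem isPairing_completion (hf : IsPairing G f Set.univ)
    (hF : ∀ x y, F.Adj x y ↔ K.Adj x y ∧ f x = y) : IsPairing (completion G K F) f Set.univ := by
  intro x hx
  obtain ⟨-, hff, hadj⟩ := hf x hx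
  refine ⟨trivial, hff, ?_⟩
  have := K.adj_comm x (f x)
  simp only [completion, hF]
  grind

theorem IsPairing.of_completion (hg : IsPairing (completion G K F) g Set.univ) (hFG : F ≤ G) :
    IsPairing G g Set.univ :=
  fun x hx => ⟨trivial, (hg x hx).2.1, (hg x hx).2.2.elim (@hFG x (g x)) And.left⟩

theorem adj_iff_of_isPairing_completion (hg : IsPairing (completion G K F) g Set.univ)
    (hF : ∀ x y, F.Adj x y ↔ K.Adj x y ∧ f x = y) (x : V) : K.Adj x (g x) ↔ K.Adj x (f x) := by
  have hadj := (hg x trivial).2.2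
  simp only [completion, hF] at hadj
  grind

end Completion

section Guess

variable {V : Type*} {G : SimpleGraph V} {C : G.EdgeLabeling Color} {M M' : G.Subgraph}
  {f g : V → V} {c : Color} {x y z : V}

theorem labelGraph_blue_adj : (C.labelGraph .blue).Adj x y ↔
    G.Adj x y ∧ ¬ (C.labelGraph .red).Adj x y := by
  simp only [SimpleGraph.EdgeLabeling.labelGraph_adj, not_exists]
  refine ⟨fun ⟨h, hblue⟩ => ⟨h, fun _ hred => nomatch hblue.symm.trans hred⟩,
    fun ⟨h, hred⟩ => ⟨h, ?_⟩⟩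
  cases hc : C.get x y h with
  | red => exact absurd hc (hred h)
  | blue => exact hc

theorem labelGraph_red_adj_congr (hy : G.Adj x y) (hz : G.Adj x z)
    (h : (C.labelGraph c).Adj x y ↔ (C.labelGraph c).Adj x z) :
    (C.labelGraph .red).Adj x y ↔ (C.labelGraph .red).Adj x z := by
  cases c with
  | red => exact h
  | blue => simpa only [labelGraph_blue_adj, hy, hz, true_and, not_iff_not] using h

theorem exists_isPairing_of_isPerfectMatching (hM : M.IsPerfectMatching) :
    ∃ f, IsPairing G f Set.univ ∧ ∀ x y, M.Adj x y ↔ f x = y := by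
  choose f hf hunique using SimpleGraph.Subgraph.isPerfectMatching_iff.1 hM
  have hadj : ∀ x y, M.Adj x y ↔ f x = y := fun x y =>
    ⟨fun h => (hunique x y h).symm, fun h => h ▸ hf x⟩
  exact ⟨f, fun x _ => ⟨trivial, (hadj _ _).1 (hf x).symm, (hf x).adj_sub⟩, hadj⟩

theorem IsPairing.exists_isPerfectMatching (hf : IsPairing G f Set.univ) :
    ∃ M : G.Subgraph, M.IsPerfectMatching ∧ ∀ x y, M.Adj x y ↔ f x = y := by
  refine ⟨⟨Set.univ, fun x y => f x = y, fun h => h ▸ (hf _ trivial).2.2, fun _ => trivial,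
    ⟨fun x y h => h ▸ (hf x trivial).2.1⟩⟩, ?_, fun _ _ => Iff.rfl⟩
  exact SimpleGraph.Subgraph.isPerfectMatching_iff.2 fun x => ⟨f x, rfl, fun y h => Eq.symm h⟩

theorem ncard_red_adj_eq_two_mul_redCount [Finite V] (hf : ∀ x y, M.Adj x y ↔ f x = y) :
    {x | (C.labelGraph .red).Adj x (f x)}.ncard = 2 * redCount C M := by
  classical
  have := Fintype.ofFinite V
  obtain ⟨K, hK⟩ : ∃ K, K = M.spanningCoe ⊓ C.labelGraph .red := ⟨_, rfl⟩
  have hadj : ∀ x y, K.Adj x y ↔ f x = y ∧ (C.labelGraph .red).Adj x y := fun x y => by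
    simp only [hK, SimpleGraph.inf_adj, SimpleGraph.Subgraph.spanningCoe_adj, hf]
  have hdegree : ∀ x, K.degree x = if (C.labelGraph .red).Adj x (f x) then 1 else 0 := by
    intro x
    have hneighbors : K.neighborFinset x =
        if (C.labelGraph .red).Adj x (f x) then {f x} else ∅ := by
      ext y
      rw [SimpleGraph.mem_neighborFinset, hadj]
      grind
    rw [← SimpleGraph.card_neighborFinset_eq_degree, hneighbors]
    split_ifs <;> rfl
  have hedges : ofColor C .red M.edgeSet = (K.edgeFinset : Set (Sym2 V)) := by
    rw [SimpleGraph.coe_edgeFinset, hK, SimpleGraph.edgeSet_inf]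
    rfl
  calc {x | (C.labelGraph .red).Adj x (f x)}.ncard
    _ = ∑ x, K.degree x := by
      rw [Set.ncard_eq_toFinset_card', Finset.sum_congr rfl fun x _ => hdegree x,
        ← Finset.card_filter, Set.toFinset_ofPred]
    _ = 2 * K.edgeFinset.card := K.sum_degrees_eq_twice_card_edges
    _ = 2 * redCount C M := by rw [redCount, hedges, Set.ncard_coe_finset]

/-- The edges of colour `c` of the matching whose symmetric difference with `M` has the same edges
of colour `c` as `E`. -/
def forcedGraph (C : G.EdgeLabeling Color) (c : Color) (M : G.Subgraph) (E : Set (Sym2 V)) :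
    SimpleGraph V :=
  C.labelGraph c ⊓ SimpleGraph.fromEdgeSet (symmDiff M.edgeSet E)

variable {E : Set (Sym2 V)}

theorem forcedGraph_adj : (forcedGraph C c M E).Adj x y ↔
    (C.labelGraph c).Adj x y ∧ ¬ (M.Adj x y ↔ s(x, y) ∈ E) := by
  have := (C.labelGraph c).ne_of_adj (a := x) (b := y)
  simp only [forcedGraph, SimpleGraph.inf_adj, SimpleGraph.fromEdgeSet_adj, Set.mem_symmDiff,
    SimpleGraph.Subgraph.mem_edgeSet]
  tauto

theorem forcedGraph_adj_of_ofColor_eq (hf : ∀ x y, M'.Adj x y ↔ f x = y)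
    (hE : ofColor C c E = ofColor C c (symmDiff M.edgeSet M'.edgeSet)) :
    (forcedGraph C c M E).Adj x y ↔ (C.labelGraph c).Adj x y ∧ f x = y := by
  have h := Set.ext_iff.1 hE s(x, y)
  simp only [ofColor, Set.mem_inter_iff, SimpleGraph.mem_edgeSet, Set.mem_symmDiff,
    SimpleGraph.Subgraph.mem_edgeSet] at h
  rw [forcedGraph_adj, ← hf]
  tauto

theorem ncard_red_adj_of_isPairing_completion [Finite V] (hM' : M'.IsPerfectMatching)
    (hE : ofColor C c E = ofColor C c (symmDiff M.edgeSet M'.edgeSet))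
    (hg : IsPairing (completion G (C.labelGraph c) (forcedGraph C c M E)) g Set.univ) :
    IsPairing G g Set.univ ∧
      {x | (C.labelGraph .red).Adj x (g x)}.ncard = 2 * redCount C M' := by
  obtain ⟨f, hf, hM'f⟩ := exists_isPairing_of_isPerfectMatching hM'
  have hgG : IsPairing G g Set.univ :=
    hg.of_completion (inf_le_left.trans C.labelGraph_le)
  refine ⟨hgG, ?_⟩
  rw [← ncard_red_adj_eq_two_mul_redCount hM'f]
  congr 1
  ext x
  exact labelGraph_red_adj_congr (hgG x trivial).2.2 (hf x trivial).2.2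
    (adj_iff_of_isPairing_completion hg (fun _ _ => forcedGraph_adj_of_ofColor_eq hM'f hE) x)

theorem matchable_completion (hM' : M'.IsPerfectMatching)
    (hE : ofColor C c E = ofColor C c (symmDiff M.edgeSet M'.edgeSet)) :
    Matchable (completion G (C.labelGraph c) (forcedGraph C c M E)) Set.univ := by
  obtain ⟨f, hf, hM'f⟩ := exists_isPairing_of_isPerfectMatching hM'
  exact ⟨f, isPairing_completion hf fun _ _ => forcedGraph_adj_of_ofColor_eq hM'f hE⟩

/-- The edges encoded by a guess: the first half of `D` contains one end of each edge, and the
second half the other one.  Edges that are loops are dummies. -/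
def guessedEdges {L : ℕ} (D : Fin (L + L) → V) : Set (Sym2 V) :=
  Set.range fun e : Fin L => s(D (e.castAdd L), D (e.natAdd L))

theorem exists_ofColor_guessedEdges_eq [Finite V] [Nonempty V] {L : ℕ}
    (hE : (ofColor C c E).ncard ≤ L) :
    ∃ D : Fin (L + L) → V, ofColor C c (guessedEdges D) = ofColor C c E := by
  have := Fintype.ofFinite (ofColor C c E)
  obtain ⟨ι⟩ : Nonempty (ofColor C c E ↪ Fin L) := Function.Embedding.nonempty_of_card_le
    (by rwa [Fintype.card_fin, ← Nat.card_eq_fintype_card])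
  obtain ⟨v⟩ := ‹Nonempty V›
  set F : Fin L → Sym2 V := Function.extend ι Subtype.val fun _ => s(v, v) with hF
  refine ⟨Fin.append (fun e => (F e).out.1) (fun e => (F e).out.2), ?_⟩
  have hguess : guessedEdges (Fin.append (fun e => (F e).out.1) (fun e => (F e).out.2)) =
      Set.range F := by
    simp only [guessedEdges, Fin.append_left, Fin.append_right]
    exact congrArg _ (funext fun e => Quot.out_eq (F e))
  rw [hguess]
  ext e
  refine ⟨?_, fun he => ⟨⟨ι ⟨e, he⟩, ι.injective.extend_apply _ _ _⟩, he.2⟩⟩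
  rintro ⟨⟨k, rfl⟩, hcolor⟩
  by_cases hk : ∃ e, ι e = k
  · obtain ⟨e, rfl⟩ := hk
    rw [hF, ι.injective.extend_apply]
    exact e.2
  · rw [hF, Function.extend_apply' _ _ _ hk] at hcolor
    exact ((C.labelGraph c).irrefl hcolor).elim

end Guess

end ExactMatching

namespace RAM

section Memory

variable (m : Memory) (a i j v : ℕ)

@[simp]
theorem Memory.write_apply_same (i' j' : ℕ) :
    m.write a i j v a i' j' = if i' = i ∧ j' = j then v else m a i' j' := by
  simp [Memory.write]

@[simp]
theorem Memory.write_of_ne {a a' : ℕ} (h : a' ≠ a) : m.write a i j v a' = m a' := by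
  funext i' j'
  simp [Memory.write, h]

end Memory

namespace Expr

/-- The scalar variable number `x`, stored in cell `(0, 0)` of array `x`. -/
abbrev var (x : ℕ) : Expr := .read x (.lit 0) (.lit 0)

/-- Entry `e` of the vector stored in row `0` of array `a`. -/
abbrev entry (a : ℕ) (e : Expr) : Expr := .read a (.lit 0) e

/-- The test `e = 0`. -/
def not (e : Expr) : Expr := .sub (.lit 1) e

/-- The test `e ≤ f`. -/
def le (e f : Expr) : Expr := .not (.sub e f)

/-- The test `e ≠ 0 ∨ f ≠ 0`. -/
def or (e f : Expr) : Expr := .add e f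

/-- The test `e ≠ 0 ∧ f ≠ 0`. -/
def and (e f : Expr) : Expr := .not (.or (.not e) (.not f))

/-- The test `e ≠ f`. -/
def ne (e f : Expr) : Expr := .or (.sub e f) (.sub f e)

/-- The test `e = f`. -/
def eq (e f : Expr) : Expr := .not (.ne e f)

/-- The test `e` succeeds. -/
def Holds (m : Memory) (e : Expr) : Prop :=
  e.eval m ≠ 0

variable {m : Memory} {e f : Expr}

instance : Decidable (e.Holds m) :=
  inferInstanceAs (Decidable (_ ≠ _))

@[simp]
theorem eval_not : e.not.eval m = if e.Holds m then 0 else 1 := by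
  by_cases h : e.Holds m
  · rw [if_pos h]
    exact Nat.sub_eq_zero_of_le (Nat.pos_of_ne_zero h)
  · rw [if_neg h]
    exact congrArg (1 - ·) (not_not.1 h)

@[simp]
theorem eval_eq : (e.eq f).eval m = if e.eval m = f.eval m then 1 else 0 := by
  simp only [Expr.eq, Expr.not, ne, Expr.or, eval]
  split_ifs <;> omega

@[simp]
theorem holds_lit {c : ℕ} : (lit c).Holds m ↔ c ≠ 0 := Iff.rfl

@[simp]
theorem holds_read {a : ℕ} : (read a e f).Holds m ↔ m a (e.eval m) (f.eval m) ≠ 0 := Iff.rfl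

@[simp]
theorem holds_not : e.not.Holds m ↔ ¬ e.Holds m := by
  simp only [Holds, Expr.not, eval]
  omega

@[simp]
theorem holds_le : (e.le f).Holds m ↔ e.eval m ≤ f.eval m := by
  simp only [Holds, le, Expr.not, eval]
  omega

@[simp]
theorem holds_or : (e.or f).Holds m ↔ e.Holds m ∨ f.Holds m := by
  simp only [Holds, Expr.or, eval]
  omega

@[simp]
theorem holds_and : (e.and f).Holds m ↔ e.Holds m ∧ f.Holds m := by
  simp only [Holds, Expr.and, Expr.not, Expr.or, eval]
  omega

@[simp]
theorem holds_ne : (e.ne f).Holds m ↔ e.eval m ≠ f.eval m := by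
  simp only [Holds, ne, Expr.or, eval]
  omega

@[simp]
theorem holds_eq : (e.eq f).Holds m ↔ e.eval m = f.eval m := by
  simp only [Holds, Expr.eq, Expr.not, ne, Expr.or, eval]
  omega

end Expr

/-- Programs whose only loops are `for x < b`, where the bound `b` is the content of the cell
`(0, j)` of array `0`. -/
inductive ForProg : Type
  | skip : ForProg
  | assign (a : ℕ) (i j e : Expr) : ForProg
  | seq (p q : ForProg) : ForProg
  | ite (e : Expr) (p q : ForProg) : ForProg
  | loop (x j : ℕ) (p : ForProg) : ForProg

notation:60 p:61 ";;" q:60 => ForProg.seq p q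

namespace ForProg

open RAM.Expr

/-- Assignment to a scalar variable. -/
abbrev set (x : ℕ) (e : Expr) : ForProg := assign x (lit 0) (lit 0) e

/-- One-armed conditional. -/
abbrev when (e : Expr) (p : ForProg) : ForProg := ite e p skip

/-- The test of the machine loop that implements `loop x j p`. -/
abbrev loopTest (x j : ℕ) : Expr := .sub (.read 0 (lit 0) (lit j)) (var x)

/-- The translation into a program of the machine. -/
def compile : ForProg → Prog
  | skip => .skip
  | assign a i j e => .assign a i j e
  | seq p q => .seq p.compile q.compile
  | ite e p q => .ite e p.compile q.compile
  | loop x j p => .seq (.assign x (lit 0) (lit 0) (lit 0))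
      (.while (loopTest x j)
        (.seq p.compile (.assign x (lit 0) (lit 0) (.add (var x) (lit 1)))))

/-- The memory after running the program. -/
def den : ForProg → Memory → Memory
  | skip, m => m
  | assign a i j e, m => m.write a (i.eval m) (j.eval m) (e.eval m)
  | seq p q, m => q.den (p.den m)
  | ite e p q, m => if e.Holds m then p.den m else q.den m
  | loop x j p, m =>
      (fun m' => (p.den m').write x 0 0 (m' x 0 0 + 1))^[m 0 0 j] (m.write x 0 0 0)

/-- The arrays to which the program may write. -/
def writes : ForProg → List ℕ
  | skip => []
  | assign a _ _ _ => [a]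
  | seq p q => p.writes ++ q.writes
  | ite _ p q => p.writes ++ q.writes
  | loop x _ p => x :: p.writes

/-- The numbers `j` of the cells `(0, j)` which are used as loop bounds. -/
def bounds : ForProg → List ℕ
  | skip => []
  | assign _ _ _ _ => []
  | seq p q => p.bounds ++ q.bounds
  | ite _ p q => p.bounds ++ q.bounds
  | loop _ j p => j :: p.bounds

/-- Loop bodies do not write to the counter of the loop, and nothing is written to array `0`, which
holds the loop bounds. -/
def IsWellFormed : ForProg → Bool
  | skip => true
  | assign a _ _ _ => a ≠ 0
  | seq p q => p.IsWellFormed && q.IsWellFormed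
  | ite _ p q => p.IsWellFormed && q.IsWellFormed
  | loop x _ p => x ≠ 0 && x ∉ p.writes && p.IsWellFormed

/-- A bound for the running time if the loop bounds are at most `b`. -/
def time (b : ℕ) : ForProg → ℕ
  | skip => 1
  | assign _ i j e => i.cost + j.cost + e.cost + 1
  | seq p q => p.time b + q.time b
  | ite e p q => e.cost + 1 + p.time b + q.time b
  | loop _ _ p => b * (p.time b + 16) + 12

variable {p q : ForProg} {m : Memory} {x j b : ℕ}

theorem den_of_notMem_writes (p : ForProg) (m : Memory) {a : ℕ} (ha : a ∉ p.writes) :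
    p.den m a = m a := by
  induction p generalizing m with
  | skip => rfl
  | assign a' i j e =>
    simp only [writes, List.mem_singleton] at ha
    exact m.write_of_ne _ _ _ ha
  | seq p q ihp ihq =>
    simp only [writes, List.mem_append, not_or] at ha
    rw [den, ihq _ ha.2, ihp _ ha.1]
  | ite e p q ihp ihq =>
    simp only [writes, List.mem_append, not_or] at ha
    rw [den]
    split_ifs
    exacts [ihp _ ha.1, ihq _ ha.2]
  | loop x j p ih =>
    simp only [writes, List.mem_cons, not_or] at ha
    have hiterate : ∀ k, ((fun m' => (p.den m').write x 0 0 (m' x 0 0 + 1))^[k]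
        (m.write x 0 0 0)) a = m a := by
      intro k
      induction k with
      | zero => exact m.write_of_ne _ _ _ ha.1
      | succ k ihk =>
        rw [Function.iterate_succ_apply', Memory.write_of_ne _ _ _ _ ha.1, ih _ ha.2, ihk]
    exact hiterate _

theorem zero_notMem_writes (hp : p.IsWellFormed) : 0 ∉ p.writes := by
  induction p <;> grind [IsWellFormed, writes]

theorem den_zero (hp : p.IsWellFormed) (m : Memory) : p.den m 0 = m 0 :=
  p.den_of_notMem_writes m (zero_notMem_writes hp)

theorem runs_while (hx0 : x ≠ 0) (hxp : x ∉ p.writes) (hp : p.IsWellFormed)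
    (hruns : ∀ s : Memory, s 0 = m 0 → ∃ t, Runs p.compile s t (p.den s) ∧ t ≤ p.time b)
    (k : ℕ) (s : Memory) (hs : s 0 = m 0) (hk : s 0 0 j = s x 0 0 + k) :
    ∃ t, Runs (.while (loopTest x j)
        (.seq p.compile (.assign x (lit 0) (lit 0) (.add (var x) (lit 1))))) s t
        ((fun m' => (p.den m').write x 0 0 (m' x 0 0 + 1))^[k] s) ∧
      t ≤ k * (p.time b + 16) + 8 := by
  induction k generalizing s with
  | zero =>
    refine ⟨_, Runs.whileFalse ?_, ?_⟩
    · simp [eval, hk]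
    · simp [cost]
  | succ k ih =>
    obtain ⟨t₁, hrun₁, ht₁⟩ := hruns s hs
    have hinc := Runs.assign x (lit 0) (lit 0) (.add (var x) (lit 1)) (p.den s)
    simp only [eval, p.den_of_notMem_writes s hxp] at hinc
    have hsizes : ((p.den s).write x 0 0 (s x 0 0 + 1)) 0 = s 0 := by
      rw [Memory.write_of_ne _ _ _ _ hx0.symm, den_zero hp]
    obtain ⟨t₂, hrun₂, ht₂⟩ := ih _ (hsizes.trans hs) (by
      rw [hsizes, hk, Memory.write_apply_same, if_pos ⟨rfl, rfl⟩]
      ring)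
    refine ⟨_, Runs.whileTrue ?_ (hrun₁.seq hinc) hrun₂, ?_⟩
    · simp [eval, hk]
    · simp only [cost, Nat.add_mul, one_mul]
      omega

theorem runs_compile (hp : p.IsWellFormed) (m : Memory) (hb : ∀ j ∈ p.bounds, m 0 0 j ≤ b) :
    ∃ t, Runs p.compile m t (p.den m) ∧ t ≤ p.time b := by
  induction p generalizing m with
  | skip => exact ⟨_, Runs.skip m, le_rfl⟩
  | assign a i j e => exact ⟨_, Runs.assign a i j e m, le_rfl⟩
  | seq p q ihp ihq =>
    simp only [IsWellFormed, Bool.and_eq_true] at hp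
    simp only [bounds, List.forall_mem_append] at hb
    obtain ⟨s, hs, hs'⟩ := ihp hp.1 m hb.1
    obtain ⟨t, ht, ht'⟩ := ihq hp.2 (p.den m) (by rw [den_zero hp.1 m]; exact hb.2)
    exact ⟨_, hs.seq ht, Nat.add_le_add hs' ht'⟩
  | ite e p q ihp ihq =>
    simp only [IsWellFormed, Bool.and_eq_true] at hp
    simp only [bounds, List.forall_mem_append] at hb
    by_cases he : e.Holds m
    · obtain ⟨t, ht, ht'⟩ := ihp hp.1 m hb.1
      refine ⟨e.cost + 1 + t, ?_, by simp only [time]; omega⟩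
      rw [den, if_pos he]
      exact Runs.iteTrue he ht
    · obtain ⟨t, ht, ht'⟩ := ihq hp.2 m hb.2
      refine ⟨e.cost + 1 + t, ?_, by simp only [time]; omega⟩
      rw [den, if_neg he]
      exact Runs.iteFalse (not_not.1 he) ht
  | loop x j p ih =>
    simp only [IsWellFormed, Bool.and_eq_true, decide_eq_true_eq] at hp
    simp only [bounds, List.forall_mem_cons] at hb
    obtain ⟨⟨hx0, hxp⟩, hp⟩ := hp
    have hsizes : (m.write x 0 0 0) 0 = m 0 := m.write_of_ne _ _ _ hx0.symm
    obtain ⟨t, ht, ht'⟩ := runs_while hx0 hxp hp (fun s hs => ih hp s (by rw [hs]; exact hb.2))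
      (m 0 0 j) (m.write x 0 0 0) hsizes
      (by rw [hsizes, Memory.write_apply_same, if_pos ⟨rfl, rfl⟩, zero_add])
    refine ⟨_, (Runs.assign x (lit 0) (lit 0) (lit 0) m).seq ht, ?_⟩
    have := Nat.mul_le_mul_right (p.time b + 16) hb.1
    simp only [cost, time]
    omega

theorem add_le_add_two_pow {b c d s t : ℕ} (hs : s ≤ (b + 2) ^ c) (ht : t ≤ (b + 2) ^ d) :
    s + t ≤ (b + 2) ^ (c + d + 1) := by
  have hc : (b + 2) ^ c ≤ (b + 2) ^ (c + d) := Nat.pow_le_pow_right (by omega) (by omega)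
  have hd : (b + 2) ^ d ≤ (b + 2) ^ (c + d) := Nat.pow_le_pow_right (by omega) (by omega)
  calc s + t ≤ (b + 2) ^ (c + d) * 2 := by omega
    _ ≤ (b + 2) ^ (c + d) * (b + 2) := Nat.mul_le_mul_left _ (by omega)
    _ = _ := (pow_succ _ _).symm

theorem le_add_two_pow (b k : ℕ) : k ≤ (b + 2) ^ k :=
  (Nat.lt_pow_self (by omega)).le

theorem exists_time_le (p : ForProg) : ∃ c, ∀ b, p.time b ≤ (b + 2) ^ c := by
  induction p with
  | skip => exact ⟨_, fun b => le_add_two_pow b _⟩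
  | assign a i j e => exact ⟨_, fun b => le_add_two_pow b _⟩
  | seq p q ihp ihq =>
    obtain ⟨c, hc⟩ := ihp
    obtain ⟨d, hd⟩ := ihq
    exact ⟨_, fun b => add_le_add_two_pow (hc b) (hd b)⟩
  | ite e p q ihp ihq =>
    obtain ⟨c, hc⟩ := ihp
    obtain ⟨d, hd⟩ := ihq
    exact ⟨_, fun b =>
      add_le_add_two_pow (add_le_add_two_pow (le_add_two_pow b (e.cost + 1)) (hc b)) (hd b)⟩
  | loop x j p ih =>
    obtain ⟨c, hc⟩ := ih
    refine ⟨_, fun b => add_le_add_two_pow (c := 1 + (c + 16 + 1)) ?_ (le_add_two_pow b 12)⟩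
    rw [pow_add, pow_one]
    exact Nat.mul_le_mul (by omega) (add_le_add_two_pow (hc b) (le_add_two_pow b 16))

theorem loop_rule (Inv : ℕ → Memory → Prop) (hb : m 0 0 j = b) (hinit : Inv 0 (m.write x 0 0 0))
    (hstep : ∀ i s, i < b → Inv i s → s x 0 0 = i → (∀ a ∉ (loop x j p).writes, s a = m a) →
      Inv (i + 1) ((p.den s).write x 0 0 (i + 1))) :
    Inv b ((loop x j p).den m) := by
  have hiterate : ∀ k ≤ b, ∀ s, s = (fun m' => (p.den m').write x 0 0 (m' x 0 0 + 1))^[k]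
      (m.write x 0 0 0) → Inv k s ∧ s x 0 0 = k ∧ ∀ a ∉ (loop x j p).writes, s a = m a := by
    intro k
    induction k with
    | zero =>
      rintro - _ rfl
      refine ⟨hinit, (m.write_apply_same ..).trans (if_pos ⟨rfl, rfl⟩),
        fun a ha => m.write_of_ne _ _ _ ?_⟩
      exact (not_or.1 (List.mem_cons.not.1 ha)).1
    | succ k ih =>
      rintro hk _ rfl
      obtain ⟨hinv, hcount, hframe⟩ := ih (by omega) _ rfl
      rw [Function.iterate_succ_apply', hcount]
      refine ⟨hstep k _ (by omega) hinv hcount hframe,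
        (Memory.write_apply_same ..).trans (if_pos ⟨rfl, rfl⟩), fun a ha => ?_⟩
      obtain ⟨hax, hap⟩ := not_or.1 (List.mem_cons.not.1 ha)
      rw [Memory.write_of_ne _ _ _ _ hax, den_of_notMem_writes _ _ hap, hframe a ha]
  rw [den, hb]
  exact (hiterate b le_rfl _ rfl).1

variable {n : ℕ}

theorem forEach_rule (Inv : Set (Fin n) → Memory → Prop) (hn : m 0 0 0 = n)
    (hwrite : ∀ S s v, Inv S s → Inv S (s.write x 0 0 v)) (hinit : Inv ∅ m)
    (hstep : ∀ S (i : Fin n) s, i ∉ S → Inv S s → s x 0 0 = (i : ℕ) →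
      (∀ a ∉ (loop x 0 p).writes, s a = m a) → Inv (insert i S) (p.den s)) :
    Inv Set.univ ((loop x 0 p).den m) := by
  have hinv := loop_rule (x := x) (p := p) (fun k s => Inv {i | i < k} s) hn
    (hwrite _ _ _ (by simpa using hinit)) fun k s hk hs hcount hframe => by
      have hset : {i : Fin n | (i : ℕ) < k + 1} = insert ⟨k, hk⟩ {i : Fin n | (i : ℕ) < k} := by
        ext i
        simp only [Set.mem_insert_iff, Set.mem_ofPred_eq, Fin.ext_iff]
        omega
      change Inv _ _
      rw [hset]
      exact hwrite _ _ _ (hstep _ _ s (by simp) hs hcount hframe)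
  simpa using hinv

theorem forEachPair_rule {y : ℕ} (Inv : Set (Fin n × Fin n) → Memory → Prop) (hn : m 0 0 0 = n)
    (hwf : (loop x 0 (loop y 0 p)).IsWellFormed)
    (hwrite : ∀ S s v, Inv S s → Inv S (s.write x 0 0 v) ∧ Inv S (s.write y 0 0 v))
    (hinit : Inv ∅ m)
    (hstep : ∀ S (i j : Fin n) s, (i, j) ∉ S → Inv S s → s x 0 0 = (i : ℕ) → s y 0 0 = (j : ℕ) →
      (∀ a ∉ (loop x 0 (loop y 0 p)).writes, s a = m a) → Inv (insert (i, j) S) (p.den s)) :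
    Inv Set.univ ((loop x 0 (loop y 0 p)).den m) := by
  simp only [IsWellFormed, Bool.and_eq_true, decide_eq_true_eq, writes, List.mem_cons,
    not_or] at hwf
  have hinv := forEach_rule (x := x) (p := loop y 0 p) (fun S s => Inv (S ×ˢ Set.univ) s) hn
    (fun S s v h => (hwrite _ s v h).1) (by simpa using hinit) fun S i s hi hs hx hframe => by
      have hs0 : s 0 = m 0 := hframe 0 (by
        simp only [writes, List.mem_cons, not_or]
        exact ⟨hwf.1.1.symm, hwf.2.1.1.symm, zero_notMem_writes hwf.2.2⟩)
      have hrow := forEach_rule (x := y) (p := p)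
        (fun T s' => Inv (S ×ˢ Set.univ ∪ {i} ×ˢ T) s') ((congrFun₂ hs0 0 0).trans hn)
        (fun T s' v h => (hwrite _ s' v h).2) (by simpa using hs)
        fun T j s' hj hs' hy hframe' => by
          have hset : S ×ˢ Set.univ ∪ {i} ×ˢ insert j T =
              insert (i, j) (S ×ˢ Set.univ ∪ {i} ×ˢ T) := by grind
          change Inv _ _
          rw [hset]
          refine hstep _ i j s' (by grind) hs' ?_ hy fun a ha => ?_
          · rw [hframe' x (by simpa [writes] using hwf.1.2), hx]
          · rw [hframe' a (not_or.1 (List.mem_cons.not.1 ha)).2, hframe a ha]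
      have hset : insert i S ×ˢ Set.univ = S ×ˢ Set.univ ∪ {i} ×ˢ (Set.univ : Set (Fin n)) := by
        grind
      change Inv _ _
      rwa [hset]
  simpa using hinv

/-- The program which replaces `a i` by `e` for all `i < n` for which the test `g` succeeds, where
`e` and `g` may refer to `i` by the variable `x`. -/
def update (x a : ℕ) (g e : Expr) : ForProg :=
  loop x 0 (when g (assign a (lit 0) (var x) e))

@[simp]
theorem writes_update (x a : ℕ) (g e : Expr) : (update x a g e).writes = [x, a] := rfl

theorem update_rule {a : ℕ} {g e : Expr} (hn : m 0 0 0 = n) (hax : a ≠ x) (i : Fin n) :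
    ∃ s, (∀ c, c ≠ x → c ≠ a → s c = m c) ∧ s x 0 0 = (i : ℕ) ∧
      s a 0 (i : ℕ) = m a 0 (i : ℕ) ∧
      (update x a g e).den m a 0 i = if g.Holds s then e.eval s else m a 0 i := by
  refine (forEach_rule (fun S s' => (∀ i ∈ S, ∃ s, (∀ c, c ≠ x → c ≠ a → s c = m c) ∧
    s x 0 0 = (i : ℕ) ∧ s a 0 (i : ℕ) = m a 0 (i : ℕ) ∧
    s' a 0 i = if g.Holds s then e.eval s else m a 0 i) ∧ ∀ i ∉ S, s' a 0 i = m a 0 i) hn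
    ?_ ?_ ?_).1 i trivial
  · exact fun S s v h => by simpa [Memory.write_of_ne _ _ _ _ hax] using h
  · exact ⟨fun i hi => hi.elim, fun i _ => rfl⟩
  · rintro S i s hi ⟨hdone, htodo⟩ hx hframe
    have hden : ∀ k : Fin n, (when g (assign a (lit 0) (var x) e)).den s a 0 k =
        if k = i then if g.Holds s then e.eval s else m a 0 i else s a 0 k := by
      intro k
      rw [← htodo i hi, den]
      split_ifs <;> simp_all [den, eval, Fin.val_inj]
    refine ⟨fun k hk => ?_, fun k hk => ?_⟩
    · by_cases hki : k = i
      · rw [hden, if_pos hki, hki]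
        exact ⟨s, fun c hcx hca => hframe c (by simp [writes, hcx, hca]), hx, htodo i hi, rfl⟩
      · rw [hden, if_neg hki]
        exact hdone k (hk.resolve_left hki)
    · rw [hden, if_neg fun h => hk (.inl h), htodo k fun h => hk (.inr h)]

/-- The program which sets all `a i j` with `i, j < n` to `e`, which may refer to `i` and `j` by the
variables `x` and `y`. -/
def table (x y a : ℕ) (e : Expr) : ForProg :=
  loop x 0 (loop y 0 (assign a (var x) (var y) e))

@[simp]
theorem writes_table (x y a : ℕ) (e : Expr) : (table x y a e).writes = [x, y, a] := rfl

theorem table_rule {y a : ℕ} {e : Expr} (hn : m 0 0 0 = n) (hd : [0, x, y, a].Nodup)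
    (i j : Fin n) :
    ∃ s, (∀ c ∉ [x, y, a], s c = m c) ∧ s x 0 0 = (i : ℕ) ∧ s y 0 0 = (j : ℕ) ∧
      (table x y a e).den m a i j = e.eval s := by
  simp only [List.nodup_cons, List.mem_cons, List.not_mem_nil, or_false, not_or] at hd
  obtain ⟨⟨h0x, h0y, h0a⟩, ⟨hxy, hxa⟩, hya, -⟩ := hd
  refine forEachPair_rule (x := x) (y := y) (p := assign a (var x) (var y) e)
    (fun S s' => ∀ i j : Fin n, (i, j) ∈ S → ∃ s, (∀ c ∉ [x, y, a], s c = m c) ∧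
      s x 0 0 = (i : ℕ) ∧ s y 0 0 = (j : ℕ) ∧ s' a i j = e.eval s) hn
    (by simp only [IsWellFormed, writes]; grind) ?_ ?_ ?_ i j trivial
  · intro S s v h
    simpa [Ne.symm hxa, Ne.symm hya] using h
  · exact fun i j hij => hij.elim
  · intro S i j s _ hdone hx hy hframe k l hkl
    have hden : (assign a (var x) (var y) e).den s a k l =
        if k = i ∧ l = j then e.eval s else s a k l := by
      simp only [den, eval, hx, hy, Memory.write_apply_same, Fin.val_inj]
    by_cases hij' : k = i ∧ l = j
    · rw [hden, if_pos hij', hij'.1, hij'.2]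
      exact ⟨s, fun c hc => hframe c (by simpa [writes] using hc), hx, hy, rfl⟩
    · rw [hden, if_neg hij']
      exact hdone k l (hkl.resolve_left fun h => hij' (Prod.mk.inj h))

/-- The program which replaces `a i` by `e` for all `i < n` for which the test `g` succeeds for some
`j < n`, where `e` and `g` may refer to `i` and `j` by the variables `x` and `y`. -/
def overwrite (x y a : ℕ) (g e : Expr) : ForProg :=
  loop x 0 (loop y 0 (when g (assign a (lit 0) (var x) e)))

theorem overwrite_rule {y a : ℕ} {g e : Expr} (r : Fin n → Fin n → Prop) (f : Fin n → ℕ)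
    (hn : m 0 0 0 = n) (hd : [0, x, y, a].Nodup)
    (hg : ∀ (i j : Fin n) s, (∀ c ∉ [x, y, a], s c = m c) → s x 0 0 = (i : ℕ) →
      s y 0 0 = (j : ℕ) → (g.Holds s ↔ r i j) ∧ (r i j → e.eval s = f i)) (i : Fin n) :
    (∀ j, r i j → (overwrite x y a g e).den m a 0 i = f i) ∧
      ((∀ j, ¬ r i j) → (overwrite x y a g e).den m a 0 i = m a 0 i) := by
  simp only [List.nodup_cons, List.mem_cons, List.not_mem_nil, or_false, not_or] at hd
  obtain ⟨⟨h0x, h0y, h0a⟩, ⟨hxy, hxa⟩, hya, -⟩ := hd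
  have hinv := forEachPair_rule (x := x) (y := y) (p := when g (assign a (lit 0) (var x) e))
    (fun S s => ∀ i : Fin n, (∀ j, (i, j) ∈ S → r i j → s a 0 i = f i) ∧
      ((∀ j, (i, j) ∈ S → ¬ r i j) → s a 0 i = m a 0 i)) hn
    (by simp only [IsWellFormed, writes]; grind) ?_ ?_ ?_
  · simpa [overwrite] using hinv i
  · intro S s v h
    simpa [Ne.symm hxa, Ne.symm hya] using h
  · simp
  · intro S i j s _ h hx hy hframe k
    obtain ⟨hguard, hvalue⟩ := hg i j s (fun c hc => hframe c (by simpa [writes] using hc)) hx hy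
    have hk := h k
    simp only [den, apply_ite (fun s : Memory => s a 0 k), hguard, eval, hx,
      Memory.write_apply_same, true_and, Fin.val_inj]
    grind

/-- The program which searches for a pair `i, j < n` for which the test `g` succeeds, where `g` may
refer to `i` and `j` by the variables `x` and `y`.  If there is one, then `a` is set to `1`, and `u`
and `v` are set to `i` and `j`; otherwise `a` is set to `0`. -/
def search (x y a u v : ℕ) (g : Expr) : ForProg :=
  set a (lit 0) ;; loop x 0 (loop y 0 (when g (set a (lit 1) ;; set u (var x) ;; set v (var y))))

theorem search_rule {y a u v : ℕ} {g : Expr} (r : Fin n → Fin n → Prop)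
    (hn : m 0 0 0 = n) (hd : [0, x, y, a, u, v].Nodup)
    (hg : ∀ (i j : Fin n) s, (∀ c ∉ [x, y, a, u, v], s c = m c) → s x 0 0 = (i : ℕ) →
      s y 0 0 = (j : ℕ) → (g.Holds s ↔ r i j)) :
    (search x y a u v g).den m a 0 0 = 0 ∧ (∀ i j, ¬ r i j) ∨
      (search x y a u v g).den m a 0 0 ≠ 0 ∧ ∃ i j : Fin n, r i j ∧
        (search x y a u v g).den m u 0 0 = i ∧ (search x y a u v g).den m v 0 0 = j := by
  simp only [List.nodup_cons, List.mem_cons, List.not_mem_nil, or_false, not_or] at hd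
  obtain ⟨⟨h0x, h0y, h0a, h0u, h0v⟩, ⟨hxy, hxa, hxu, hxv⟩, ⟨hya, hyu, hyv⟩, ⟨hau, hav⟩, huv, -⟩ :=
    hd
  have hinv := forEachPair_rule (m := m.write a 0 0 0) (x := x) (y := y)
    (p := when g (set a (lit 1) ;; set u (var x) ;; set v (var y))) (n := n)
    (fun S s => s a 0 0 = 0 ∧ (∀ i j, (i, j) ∈ S → ¬ r i j) ∨
      s a 0 0 ≠ 0 ∧ ∃ i j : Fin n, r i j ∧ s u 0 0 = i ∧ s v 0 0 = j)
    (by simpa [h0a] using hn) (by simp only [IsWellFormed, writes]; grind) ?_ ?_ ?_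
  · simpa [search, den, eval] using hinv
  · intro S s v h
    simpa [Ne.symm hxa, Ne.symm hya, Ne.symm hxu, Ne.symm hxv, Ne.symm hyu, Ne.symm hyv] using h
  · simp
  · intro S i j s _ h hx hy hframe
    have hguard := hg i j s (fun c hc => by
      rw [hframe c (by simpa [writes] using hc), m.write_of_ne _ _ _ (by grind)]) hx hy
    by_cases hr : r i j
    · exact .inr ⟨by simp [den, hguard.2 hr, eval, hau, hav], i, j, hr,
        by simp [den, hguard.2 hr, eval, hx, hxa, huv],
        by simp [den, hguard.2 hr, eval, hy, hya, hyu]⟩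
    · simp only [den, if_neg (hguard.not.2 hr)]
      grind

/-- The program which sets `a` to the sum of the values of `e` for all `i < n`, where `e` may refer
to `i` by the variable `x`. -/
def sum (x a : ℕ) (e : Expr) : ForProg :=
  set a (lit 0) ;; loop x 0 (set a (.add (var a) e))

theorem sum_rule {a : ℕ} {e : Expr} (f : Fin n → ℕ) (hn : m 0 0 0 = n) (ha : a ≠ 0) (hax : a ≠ x)
    (hf : ∀ (i : Fin n) s, (∀ c, c ≠ x → c ≠ a → s c = m c) → s x 0 0 = (i : ℕ) →
      e.eval s = f i) : (sum x a e).den m a 0 0 = ∑ i, f i := by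
  have hinv := forEach_rule (m := m.write a 0 0 0) (x := x) (p := set a (.add (var a) e)) (n := n)
    (fun S s => s a 0 0 = ∑ᶠ i ∈ S, f i) (by simpa [ha.symm] using hn) ?_ ?_ ?_
  · simpa [sum, den, eval, finsum_eq_sum_of_fintype] using hinv
  · intro S s v h
    simpa [hax] using h
  · simp
  · intro S i s hi h hx hframe
    have hvalue := hf i s (fun c hcx hca => (hframe c (by simp [writes, hcx, hca])).trans
      (m.write_of_ne _ _ _ hca)) hx
    change _ = ∑ᶠ k ∈ insert i S, f k
    rw [finsum_mem_insert f hi S.toFinite, ← h, ← hvalue]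
    simp [den, eval, Nat.add_comm]

end ForProg
end RAM

namespace ExactMatching

open RAM RAM.Expr RAM.ForProg

-- Arrays `1` to `4` are those of `inputMemory` and `Outputs`.  Loop counters and other scalars are
-- stored in cell `(0, 0)` of the arrays `20` to `39`.
namespace Register

abbrev graph : ℕ := 1
abbrev red : ℕ := 2
abbrev matching : ℕ := 3
abbrev output : ℕ := 4
abbrev current : ℕ := 5
abbrev mate : ℕ := 6
abbrev outer : ℕ := 7
abbrev inner : ℕ := 8
abbrev base : ℕ := 9
abbrev parent : ℕ := 10
abbrev rank : ℕ := 11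
abbrev passed : ℕ := 12
abbrev oldMate : ℕ := 13
abbrev target : ℕ := 14
abbrev forced : ℕ := 15
abbrev listed : ℕ := 16
abbrev covered : ℕ := 17
abbrev digit : ℕ := 18
abbrev i : ℕ := 20
abbrev j : ℕ := 21
abbrev round : ℕ := 22
abbrev step : ℕ := 23
abbrev active : ℕ := 24
abbrev u : ℕ := 25
abbrev v : ℕ := 26
abbrev left : ℕ := 27
abbrev right : ℕ := 28
abbrev spare : ℕ := 29
abbrev found : ℕ := 30
abbrev x : ℕ := 31
abbrev y : ℕ := 32
abbrev r : ℕ := 33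
abbrev defects : ℕ := 34
abbrev reds : ℕ := 35
abbrev carry : ℕ := 36
abbrev product : ℕ := 37
abbrev guess : ℕ := 38
abbrev total : ℕ := 39

attribute [simp] graph red matching output current mate outer inner base parent rank passed oldMate
  target forced listed covered digit i j round step active u v left right spare found x y r defects
  reds carry product guess total

end Register

open Register

section Storage

variable {n : ℕ} (A : ℕ → ℕ → ℕ)

/-- Row `0` of the array `A` contains the values of `f`. -/
def StoresMap (f : Fin n → ℕ) : Prop :=
  ∀ x : Fin n, A 0 x = f x

/-- Row `0` of the array `A` contains nonzero entries precisely at the elements of `S`. -/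
def StoresSet (S : Set (Fin n)) : Prop :=
  ∀ x : Fin n, A 0 x ≠ 0 ↔ x ∈ S

/-- The nonzero entries of the array `A` are those of the adjacency matrix of `H`. -/
def StoresGraph (H : SimpleGraph (Fin n)) : Prop :=
  ∀ x y : Fin n, A x y ≠ 0 ↔ H.Adj x y

/-- The memory contains the state `F` of the search for augmenting paths. -/
structure StoresForest (m : Memory) (F : Forest (Fin n)) : Prop where
  outer : StoresSet (m outer) F.outer
  inner : StoresSet (m inner) F.inner
  base : StoresMap (m base) fun x => F.base x
  parent : StoresMap (m parent) fun x => F.parent x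
  rank : StoresMap (m rank) F.rank

variable {A} {m : Memory} {x y a : ℕ} {g e : Expr}

theorem storesMap_update {f : Fin n → ℕ} (hn : m 0 0 0 = n) (hax : a ≠ x)
    (h : ∀ (i : Fin n) s, (∀ c, c ≠ x → c ≠ a → s c = m c) → s x 0 0 = (i : ℕ) →
      s a 0 (i : ℕ) = m a 0 (i : ℕ) →
        (g.Holds s → e.eval s = f i) ∧ (¬ g.Holds s → m a 0 i = f i)) :
    StoresMap ((update x a g e).den m a) f := fun i => by
  obtain ⟨s, hs, hx, ha, heq⟩ := update_rule (m := m) (g := g) (e := e) hn hax i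
  rw [heq]
  split_ifs with hg
  exacts [(h i s hs hx ha).1 hg, (h i s hs hx ha).2 hg]

theorem storesSet_update {S : Set (Fin n)} (hn : m 0 0 0 = n) (hax : a ≠ x)
    (h : ∀ (i : Fin n) s, (∀ c, c ≠ x → c ≠ a → s c = m c) → s x 0 0 = (i : ℕ) →
      ((if g.Holds s then e.Holds s else m a 0 i ≠ 0) ↔ i ∈ S)) :
    StoresSet ((update x a g e).den m a) S := fun i => by
  obtain ⟨s, hs, hx, -, heq⟩ := update_rule (m := m) (g := g) (e := e) hn hax i
  rw [heq, ← h i s hs hx]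
  split_ifs <;> rfl

theorem storesSet_write {S : Set (Fin n)} (h : StoresSet (m a) S) (i : Fin n) :
    StoresSet (m.write a 0 i 1 a) (insert i S) := fun k => by
  have := h k
  simp only [Memory.write_apply_same, true_and, Fin.val_inj, Set.mem_insert_iff]
  split_ifs <;> simp_all

theorem storesGraph_table {H : SimpleGraph (Fin n)} (hn : m 0 0 0 = n)
    (hd : [0, x, y, a].Nodup)
    (h : ∀ (i j : Fin n) s, (∀ c ∉ [x, y, a], s c = m c) → s x 0 0 = (i : ℕ) →
      s y 0 0 = (j : ℕ) → (e.Holds s ↔ H.Adj i j)) :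
    StoresGraph ((table x y a e).den m a) H := fun i j => by
  obtain ⟨s, hs, hx, hy, heq⟩ := table_rule (m := m) (e := e) hn hd i j
  rw [heq]
  exact h i j s hs hx hy

end Storage

section Search

variable {n : ℕ} {m : Memory} {H : SimpleGraph (Fin n)} {N : Fin n → Fin n}

/-- The program which installs the trivial forest of the stored matching. -/
def startForest : ForProg :=
  update i outer (lit 1) (eq (entry mate (var i)) (var i)) ;;
  update i inner (lit 1) (lit 0) ;;
  update i base (lit 1) (var i) ;;
  update i parent (lit 1) (var i) ;;
  update i rank (lit 1) (lit 0)

theorem storesForest_startForest (hn : m 0 0 0 = n) (hN : StoresMap (m mate) fun x => N x) :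
    StoresForest (startForest.den m) (Forest.init N) := by
  constructor <;> simp only [startForest, den] <;>
    repeat rw [den_of_notMem_writes _ _ (by decide)]
  · refine storesSet_update hn (by decide) fun x s hs hx => ?_
    simp [eval, hx, hs, hN x, Forest.init, Fin.val_inj]
  · refine storesSet_update (by simpa [den_of_notMem_writes] using hn) (by decide)
      fun x s _ _ => ?_
    simp [Forest.init]
  all_goals
    refine storesMap_update (by simpa [den_of_notMem_writes] using hn) (by decide)
      fun x s _ hx _ => ?_
    simp [eval, hx, Forest.init]

theorem storesForest_congr {m' : Memory} {F : Forest (Fin n)} (h : StoresForest m F)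
    (hm : ∀ c ∈ [outer, inner, base, parent, rank], m' c = m c) : StoresForest m' F := by
  simp only [List.forall_mem_cons] at hm
  obtain ⟨h₁, h₂, h₃, h₄, h₅, -⟩ := hm
  exact ⟨h₁ ▸ h.outer, h₂ ▸ h.inner, h₃ ▸ h.base, h₄ ▸ h.parent, h₅ ▸ h.rank⟩

/-- The memory contains the two ends `a` and `b` of a climb and the set `Q` of passed vertices. -/
structure StoresClimb (m : Memory) (a b : Fin n) (Q : Set (Fin n)) : Prop where
  left : m left 0 0 = a
  right : m right 0 0 = b
  passed : StoresSet (m passed) Q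

theorem storesClimb_congr {m' : Memory} {a b : Fin n} {Q : Set (Fin n)} (h : StoresClimb m a b Q)
    (hm : ∀ c ∈ [left, right, passed], m' c = m c) : StoresClimb m' a b Q := by
  simp only [List.forall_mem_cons] at hm
  obtain ⟨h₁, h₂, h₃, -⟩ := hm
  exact ⟨h₁ ▸ h.left, h₂ ▸ h.right, h₃ ▸ h.passed⟩

/-- The program which makes the end of larger rank the left end of the climb. -/
def orderEnds : ForProg :=
  when (not (le (entry rank (var right)) (entry rank (var left))))
    (set spare (var left) ;; set left (var right) ;; set right (var spare))

/-- The program which moves the left end of the climb one blossom up. -/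
def climbLeft : ForProg :=
  when (and (ne (var left) (var right)) (ne (entry mate (var left)) (var left)))
    (assign passed (lit 0) (entry mate (var left)) (lit 1) ;;
      assign passed (lit 0) (var left) (lit 1) ;;
      set left (entry base (entry parent (entry mate (var left)))))

/-- The program which starts the climb from the blossoms of the ends of an active edge `u v`. -/
def startClimb : ForProg :=
  set left (entry base (var u)) ;; set right (entry base (var v)) ;; update i passed (lit 1) (lit 0)

/-- The program which climbs from the blossoms of the ends of an active edge `u v` towards the
roots, until both ends of the climb meet or have reached roots. -/
def climb : ForProg :=
  startClimb ;; loop step 0 (orderEnds ;; climbLeft)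

variable {F : Forest (Fin n)} {a b : Fin n} {Q : Set (Fin n)}

theorem exists_storesClimb_orderEnds (hS : StoresForest m F)
    (hm : StoresClimb m a b Q) (h : F.IsClimb H N a b Q) :
    ∃ a' b', StoresClimb (orderEnds.den m) a' b' Q ∧ F.IsClimb H N a' b' Q ∧
      F.rank b' ≤ F.rank a' ∧ (a' = a ∧ b' = b ∨ a' = b ∧ b' = a) := by
  by_cases hrank : F.rank b ≤ F.rank a
  · refine ⟨a, b, ?_, h, hrank, .inl ⟨rfl, rfl⟩⟩
    have hden : orderEnds.den m = m := by
      simp [orderEnds, den, eval, hm.left, hm.right, hS.rank a, hS.rank b, hrank]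
    rwa [hden]
  · refine ⟨b, a, ?_, h.symm, le_of_not_ge hrank, .inr ⟨rfl, rfl⟩⟩
    have hleft := hm.left
    have hright := hm.right
    constructor <;> simp_all [orderEnds, den, eval, hS.rank a, hS.rank b, hm.passed]

theorem exists_storesClimb_climbLeft (hN : StoresMap (m mate) fun x => N x) (hmate : IsMate H N)
    (hS : StoresForest m F) (hF : F.IsAlternating H N) (hm : StoresClimb m a b Q)
    (h : F.IsClimb H N a b Q) (hrank : F.rank b ≤ F.rank a) :
    ∃ a' Q', StoresClimb (climbLeft.den m) a' b Q' ∧ F.IsClimb H N a' b Q' ∧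
      ((a' = b ∨ N a' = a' ∧ N b = b) ∨ a ≠ b ∧ N a ≠ a ∧ Q.ncard < Q'.ncard) := by
  have hleft := hm.left
  have hright := hm.right
  by_cases hab : a = b ∨ N a = a
  · have hden : climbLeft.den m = m := by
      simp only [climbLeft, den, holds_and, holds_ne, eval, hm.left, hm.right, hN a, ne_eq,
        Fin.val_inj]
      exact if_neg (by tauto)
    refine ⟨a, Q, by rwa [hden], h, .inl (hab.imp_right fun ha => ⟨ha, ?_⟩)⟩
    have := (hF.root a ha).2.2
    exact hF.mate_eq_of_rank_eq_zero hmate h.isBase_right (by omega)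
  · rw [not_or] at hab
    refine ⟨_, _, ?_, h.step hF hmate hab.1 hrank hab.2, .inr ⟨hab.1, hab.2, ?_⟩⟩
    · have hpassed := hm.passed
      constructor <;> simp_all [climbLeft, den, eval, hN a, hS.parent _, hS.base _, Fin.val_inj,
        storesSet_write]
    · exact Set.ncard_lt_ncard
        ⟨fun x hx => .inr (.inr hx), fun hsub => h.left_notMem (hsub (.inl rfl))⟩

theorem exists_storesClimb_climbStep {k : ℕ} (hN : StoresMap (m mate) fun x => N x)
    (hmate : IsMate H N) (hS : StoresForest m F) (hF : F.IsAlternating H N)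
    (hm : StoresClimb m a b Q) (h : F.IsClimb H N a b Q)
    (hfinished : (a = b ∨ N a = a ∧ N b = b) ∨ k ≤ Q.ncard) :
    ∃ a b Q, StoresClimb ((orderEnds ;; climbLeft).den m) a b Q ∧ F.IsClimb H N a b Q ∧
      ((a = b ∨ N a = a ∧ N b = b) ∨ k + 1 ≤ Q.ncard) := by
  obtain ⟨a', b', hm', h', hrank, hends⟩ := exists_storesClimb_orderEnds hS hm h
  have hN' : StoresMap (orderEnds.den m mate) fun x => N x := by
    rwa [den_of_notMem_writes _ _ (by decide)]
  have hS' := storesForest_congr hS fun c hc =>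
    orderEnds.den_of_notMem_writes m (by revert c; decide)
  obtain ⟨a'', Q', hm'', h'', hQ⟩ := exists_storesClimb_climbLeft hN' hmate hS' hF hm' h' hrank
  exact ⟨a'', b', Q', hm'', h'', by grind⟩

theorem storesClimb_startClimb (hn : m 0 0 0 = n) (hS : StoresForest m F) (hu : m u 0 0 = a)
    (hv : m v 0 0 = b) : StoresClimb (startClimb.den m) (F.base a) (F.base b) ∅ := by
  constructor
  · simp [startClimb, den, den_of_notMem_writes, eval, hu, hS.base a]
  · simp [startClimb, den, den_of_notMem_writes, eval, hv, hS.base b]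
  · exact storesSet_update (by simpa [den, den_of_notMem_writes] using hn) (by decide)
      fun x s _ _ => by simp

theorem exists_storesClimb_climb (hn : m 0 0 0 = n) (hN : StoresMap (m mate) fun x => N x)
    (hmate : IsMate H N) (hS : StoresForest m F) (hF : F.IsAlternating H N)
    (hu : m u 0 0 = a) (hv : m v 0 0 = b) (hactive : F.IsActive H a b) (hb : b ∈ F.outer) :
    ∃ a b Q, StoresClimb (climb.den m) a b Q ∧ F.IsClimb H N a b Q ∧
      (a = b ∨ N a = a ∧ N b = b) := by
  obtain ⟨ha, hadj, -, hne⟩ := hactive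
  have hstart := storesClimb_startClimb hn hS hu hv
  have hn' : startClimb.den m 0 0 0 = n := by rwa [den_of_notMem_writes _ _ (by decide)]
  have hloop := loop_rule (x := step) (p := orderEnds ;; climbLeft)
    (fun k s => ∃ a b Q, StoresClimb s a b Q ∧ F.IsClimb H N a b Q ∧
      ((a = b ∨ N a = a ∧ N b = b) ∨ k ≤ Q.ncard)) hn'
    ⟨_, _, _, storesClimb_congr hstart (by simp), .start hF ha hb hadj hne, .inr (Nat.zero_le _)⟩ ?_
  · obtain ⟨a, b, Q, hm, h, hfinished⟩ := hloop
    refine ⟨a, b, Q, hm, h, hfinished.resolve_right fun hQ => ?_⟩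
    have := Set.ncard_lt_ncard
      (Set.ssubset_univ_iff.2 fun hQ : Q = Set.univ => h.left_notMem (hQ ▸ Set.mem_univ a))
    rw [Set.ncard_univ, Nat.card_fin] at this
    omega
  · rintro k s - ⟨a, b, Q, hm, h, hfinished⟩ - hframe
    have hframe' : ∀ c ∈ [mate, outer, inner, base, parent, rank], s c = m c := fun c hc => by
      rw [hframe c (by revert c; decide), den_of_notMem_writes _ _ (by revert c; decide)]
    have hS' := storesForest_congr hS fun c hc => hframe' c (List.mem_cons_of_mem _ hc)
    have hN' : StoresMap (s mate) fun x => N x := by rwa [hframe' mate (by decide)]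
    obtain ⟨a, b, Q, hm, h, hfinished⟩ :=
      exists_storesClimb_climbStep hN' hmate hS' hF hm h hfinished
    exact ⟨a, b, Q, storesClimb_congr hm (by simp), h, hfinished⟩

/-- The program which adds the edge from `v` to its mate to the forest, as a child of `u`. -/
def growForest : ForProg :=
  assign outer (lit 0) (entry mate (var v)) (lit 1) ;;
  assign inner (lit 0) (var v) (lit 1) ;;
  assign parent (lit 0) (var v) (var u) ;;
  assign rank (lit 0) (entry mate (var v)) (.add (entry rank (entry base (var u))) (lit 1))

theorem storesForest_growForest (hN : StoresMap (m mate) fun x => N x) (hS : StoresForest m F)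
    (hu : m u 0 0 = a) (hv : m v 0 0 = b) : StoresForest (growForest.den m) (F.grow N a b) := by
  obtain ⟨houter, hinner, hbase, hparent, hrank⟩ := hS
  constructor
  · simpa [growForest, den, eval, hv, hN b] using! storesSet_write houter (N b)
  · simpa [growForest, den, eval, hv, hN b] using!
      storesSet_write (m := m.write outer 0 (N b) 1) (by simpa using hinner) b
  · simpa [growForest, den, eval] using! hbase
  · intro x
    simp [growForest, den, eval, hu, hv, hparent x, Forest.grow, Function.update_apply, Fin.val_inj,
      apply_ite Fin.val]
  · intro x
    simp [growForest, den, eval, hu, hv, hN b, hbase a, hrank _, Forest.grow, Function.update_apply,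
      Fin.val_inj]

/-- The program which shrinks the passed blossoms and inner vertices into the blossom with base
`left`. -/
def shrinkForest : ForProg :=
  update i outer (entry passed (entry base (var i))) (lit 1) ;;
  update i inner (entry passed (entry base (var i))) (lit 0) ;;
  update i base (entry passed (entry base (var i))) (var left)

theorem storesForest_shrinkForest (hn : m 0 0 0 = n) (hS : StoresForest m F)
    (hm : StoresClimb m a b Q) : StoresForest (shrinkForest.den m) (F.shrink a Q) := by
  obtain ⟨houter, hinner, hbase, hparent, hrank⟩ := hS
  obtain ⟨hleft, -, hpassed⟩ := hm
  constructor <;> simp only [shrinkForest, den] <;>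
    repeat rw [den_of_notMem_writes _ _ (by decide)]
  · refine storesSet_update hn (by decide) fun x s hs hx => ?_
    have hguard : (entry passed (entry base (var i))).Holds s ↔ F.base x ∈ Q := by
      simp [eval, hx, hs, hbase x, hpassed (F.base x)]
    split_ifs with hxQ <;> rw [hguard] at hxQ <;> simp [hxQ, houter x, Forest.shrink]
  · refine storesSet_update (by simpa [den_of_notMem_writes] using hn) (by decide)
      fun x s hs hx => ?_
    simp [eval, hx, hs, hbase x, hpassed (F.base x), hinner x, Forest.shrink,
      den_of_notMem_writes, and_comm]
  · refine storesMap_update (by simpa [den_of_notMem_writes] using hn) (by decide)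
      fun x s hs hx hself => ?_
    have hguard : (entry passed (entry base (var i))).Holds s ↔ F.base x ∈ Q := by
      simp [eval, hx, hs, hself, hbase x, hpassed (F.base x), den_of_notMem_writes]
    simp only [hguard]
    refine ⟨fun hxQ => ?_, fun hxQ => ?_⟩
    · simp [eval, hs, hleft, hxQ, Forest.shrink, den_of_notMem_writes]
    · simp [hbase x, hxQ, Forest.shrink, den_of_notMem_writes]
  · exact hparent
  · exact hrank

/-- The program which extends the forest along an active edge `u v` with both ends outer, or sets
`found` if that edge yields an augmenting path. -/
def shrinkOrFind : ForProg :=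
  climb ;; ite (ne (var left) (var right)) (set found (lit 1)) shrinkForest

/-- The memory contains the graph `H` and a matching `N` of `H` with exactly two exposed
vertices. -/
structure StoresInstance (m : Memory) (H : SimpleGraph (Fin n)) (N : Fin n → Fin n) : Prop where
  size : m 0 0 0 = n
  current : StoresGraph (m current) H
  mate : StoresMap (m mate) fun x => N x
  isMate : IsMate H N
  exposed : ∃ r r', r ≠ r' ∧ ∀ x, N x = x ↔ x = r ∨ x = r'

theorem storesInstance_congr {m' : Memory} (h : StoresInstance m H N)
    (hm : ∀ c ∈ [0, current, mate], m' c = m c) : StoresInstance m' H N := by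
  simp only [List.forall_mem_cons] at hm
  obtain ⟨h₁, h₂, h₃, -⟩ := hm
  exact ⟨h₁ ▸ h.size, h₂ ▸ h.current, h₃ ▸ h.mate, h.isMate, h.exposed⟩

/-- The memory contains the state of a search for an augmenting path: either `found` is set and a
perfect matching exists, or an alternating forest with the property `P` is stored. -/
def StoresSearch (m : Memory) (H : SimpleGraph (Fin n)) (N : Fin n → Fin n)
    (P : Forest (Fin n) → Prop) : Prop :=
  m found 0 0 ≠ 0 ∧ Matchable H Set.univ ∨
    m found 0 0 = 0 ∧ ∃ F : Forest (Fin n), StoresForest m F ∧ F.IsAlternating H N ∧ P F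

theorem storesSearch_shrinkOrFind (hm : StoresInstance m H N) (hfound : m found 0 0 = 0)
    (hS : StoresForest m F) (hF : F.IsAlternating H N) (hu : m u 0 0 = a) (hv : m v 0 0 = b)
    (hactive : F.IsActive H a b) (hb : b ∈ F.outer) :
    StoresSearch (shrinkOrFind.den m) H N fun F' => F.outer.ncard < F'.outer.ncard := by
  obtain ⟨a', b', Q, hm', h, hends⟩ :=
    exists_storesClimb_climb hm.size hm.mate hm.isMate hS hF hu hv hactive hb
  by_cases hab : a' = b'
  · subst hab
    have hden : shrinkOrFind.den m = shrinkForest.den (climb.den m) :=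
      if_neg (by simp [eval, hm'.left, hm'.right])
    have hS' := storesForest_congr hS fun c hc => climb.den_of_notMem_writes m (by revert c; decide)
    rw [StoresSearch, hden]
    refine .inr ⟨?_, F.shrink a' Q, ?_, h.shrink hF hm.isMate, ?_⟩
    · rwa [den_of_notMem_writes _ _ (by decide), den_of_notMem_writes _ _ (by decide)]
    · exact storesForest_shrinkForest
        (by rw [den_of_notMem_writes _ _ (by decide), hm.size]) hS' hm'
    · obtain ⟨y, hy, hyQ⟩ := h.exists_inner rfl
      exact Set.ncard_lt_ncard ⟨Set.subset_union_left, fun hsub =>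
        hF.notMem_inner y (hsub (.inr hyQ)) hy⟩
  · obtain ⟨r, r', -, hexposed⟩ := hm.exposed
    refine .inl ⟨?_, h.matchable_univ hF hm.isMate hab fun x => ?_⟩
    · simp [shrinkOrFind, den, eval, hm'.left, hm'.right, hab, Fin.val_inj]
    · grind

/-- The program which searches for an active edge `u v`. -/
def searchActive : ForProg :=
  search i j active u v (and (and (entry outer (var i)) (read current (var i) (var j)))
    (and (not (entry inner (var j))) (ne (entry base (var i)) (entry base (var j)))))

/-- The program which extends the forest along an active edge, if there is one. -/
def extendForest : ForProg :=
  searchActive ;; when (var active) (ite (entry outer (var v)) shrinkOrFind growForest)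

theorem searchActive_cases (hm : StoresInstance m H N) (hS : StoresForest m F) :
    searchActive.den m active 0 0 = 0 ∧ (∀ a b, ¬ F.IsActive H a b) ∨
      searchActive.den m active 0 0 ≠ 0 ∧ ∃ a b, F.IsActive H a b ∧
        searchActive.den m u 0 0 = a ∧ searchActive.den m v 0 0 = b := by
  refine search_rule (F.IsActive H) hm.size (by decide) fun a b s hs ha hb => ?_
  simp [eval, ha, hb, hs, hm.current a b, hS.outer a, hS.inner b, hS.base a, hS.base b,
    Forest.IsActive, Fin.val_inj, and_assoc]

theorem storesSearch_extendForest (hm : StoresInstance m H N) (hfound : m found 0 0 = 0)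
    (hS : StoresForest m F) (hF : F.IsAlternating H N) :
    StoresSearch (extendForest.den m) H N fun F' =>
      ¬ Matchable H Set.univ ∨ F.outer.ncard < F'.outer.ncard := by
  have hframe : ∀ c ∉ searchActive.writes, searchActive.den m c = m c := fun c hc =>
    den_of_notMem_writes _ _ hc
  have hm' := storesInstance_congr hm fun c hc => hframe c (by revert c; decide)
  have hS' := storesForest_congr hS fun c hc => hframe c (by revert c; decide)
  have hfound' : searchActive.den m found 0 0 = 0 := by rwa [hframe found (by decide)]
  rcases searchActive_cases hm hS with ⟨h, hstuck⟩ | ⟨h, a, b, hactive, ha, hb⟩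
  · have hden : extendForest.den m = searchActive.den m := if_neg (not_not.2 h)
    obtain ⟨r, r', -, hexposed⟩ := hm.exposed
    rw [StoresSearch, hden]
    exact .inr ⟨hfound', F, hS', hF, .inl <|
      hF.not_matchable_of_forall_not_isActive hm.isMate ((hexposed r).2 (.inl rfl)) hstuck⟩
  by_cases houter : b ∈ F.outer
  · have hden : extendForest.den m = shrinkOrFind.den (searchActive.den m) :=
      (if_pos h).trans (if_pos (by simpa [eval, hb] using (hS'.outer b).2 houter))
    rw [hden]
    exact (storesSearch_shrinkOrFind hm' hfound' hS' hF ha hb hactive houter).imp_right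
      fun ⟨h, F, hS, hF, hlt⟩ => ⟨h, F, hS, hF, .inr hlt⟩
  · have hden : extendForest.den m = growForest.den (searchActive.den m) :=
      (if_pos h).trans (if_neg (by simpa [eval, hb] using (hS'.outer b).not.2 houter))
    rw [StoresSearch, hden]
    refine .inr ⟨?_, F.grow N a b, storesForest_growForest hm'.mate hS' ha hb,
      hF.grow hm.isMate hactive.1 hactive.2.1 houter hactive.2.2.1, .inr ?_⟩
    · rwa [den_of_notMem_writes _ _ (by decide)]
    · have hmem := (hF.mate_notMem hm.isMate houter hactive.2.2.1).1
      exact Set.ncard_lt_ncard (Set.ssubset_insert hmem)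

/-- The program which decides whether the current graph has a perfect matching. -/
def decideMatchable : ForProg :=
  startForest ;; set found (lit 0) ;; loop round 0 (when (not (var found)) extendForest)

theorem storesSearch_congr {m' : Memory} {P : Forest (Fin n) → Prop} (h : StoresSearch m H N P)
    (hm : ∀ c ∈ [found, outer, inner, base, parent, rank], m' c = m c) :
    StoresSearch m' H N P := by
  obtain ⟨hfound, hm⟩ := List.forall_mem_cons.1 hm
  rw [StoresSearch, hfound]
  exact h.imp_right fun ⟨h, F, hS, hF⟩ => ⟨h, F, storesForest_congr hS hm, hF⟩

theorem decideMatchable_ne_zero_iff (hm : StoresInstance m H N) :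
    decideMatchable.den m found 0 0 ≠ 0 ↔ Matchable H Set.univ := by
  let P (k : ℕ) (F : Forest (Fin n)) := ¬ Matchable H Set.univ ∨ k < F.outer.ncard
  have hloop := loop_rule (x := round) (j := 0) (p := when (not (var found)) extendForest)
    (b := n) (m := (set found (lit 0)).den (startForest.den m))
    (fun k s => StoresSearch s H N (P k)) ?_ ?_ ?_
  · change StoresSearch (decideMatchable.den m) H N (P n) at hloop
    rcases hloop with ⟨hfound, hmatchable⟩ | ⟨hfound, F, -, -, hP⟩
    · exact iff_of_true hfound hmatchable
    · refine iff_of_false (not_not.2 hfound) (hP.resolve_right ?_)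
      simpa using Set.ncard_le_card F.outer
  · rw [den_of_notMem_writes _ _ (by decide), den_of_notMem_writes _ _ (by decide), hm.size]
  · obtain ⟨r, r', -, hexposed⟩ := hm.exposed
    have hroot : r ∈ (Forest.init N).outer := (hexposed r).2 (.inl rfl)
    refine .inr ⟨by simp [den, eval], Forest.init N, ?_, Forest.isAlternating_init H N,
      .inr ((Set.ncard_pos).2 ⟨r, hroot⟩)⟩
    exact storesForest_congr (storesForest_startForest hm.size hm.mate)
      fun c hc => den_of_notMem_writes (set found (lit 0) ;; set round (lit 0)) _
        (by revert c; decide)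
  · rintro k s - h - hframe
    have hm' := storesInstance_congr (m' := s) hm fun c hc => by
      rw [hframe c (by revert c; decide), den_of_notMem_writes _ _ (by revert c; decide),
        den_of_notMem_writes _ _ (by revert c; decide)]
    refine storesSearch_congr (m := (when (not (var found)) extendForest).den s) ?_
      fun c hc => Memory.write_of_ne _ _ _ _ (by revert c; decide)
    rcases h with ⟨hfound, hmatchable⟩ | ⟨hfound, F, hS, hF, hP⟩
    · exact .inl ⟨by simp [den, eval, hfound], hmatchable⟩
    · have hden : (when (not (var found)) extendForest).den s = extendForest.den s :=
        if_pos (by simp [eval, hfound])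
      rw [hden]
      exact (storesSearch_extendForest hm' hfound hS hF).imp_right
        fun ⟨h, F', hS', hF', hgrow⟩ => ⟨h, F', hS', hF', by grind⟩

end Search

section Exchange

variable {n : ℕ} {m : Memory} {H T : SimpleGraph (Fin n)} {N : Fin n → Fin n} {a b : Fin n}

/-- The program which sets both entries of the pair `x y` in the current graph to `v`. -/
def setPair (v : ℕ) : ForProg :=
  assign current (var x) (var y) (lit v) ;; assign current (var y) (var x) (lit v)

theorem setPair_current (ha : m x 0 0 = a) (hb : m y 0 0 = b) (v : ℕ) (k l : Fin n) :
    (setPair v).den m current k l = if s(k, l) = s(a, b) then v else m current k l := by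
  simp only [setPair, den, eval, ha, hb, Memory.write_apply_same, Fin.val_inj, Sym2.eq_iff]
  grind [Memory.write]

theorem storesInstance_setPair_zero (hm : StoresInstance m H N) (hne : N a ≠ b)
    (ha : m x 0 0 = a) (hb : m y 0 0 = b) :
    StoresInstance ((setPair 0).den m) (H.deleteEdges {s(a, b)}) N where
  size := by rw [den_of_notMem_writes _ _ (by decide), hm.size]
  current k l := by
    rw [setPair_current ha hb, SimpleGraph.deleteEdges_adj, ← hm.current k l, Set.mem_singleton_iff]
    split_ifs with h <;> simp [h]
  mate := by
    rw [den_of_notMem_writes _ _ (by decide)]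
    exact hm.mate
  isMate := hm.isMate.deleteEdges hne
  exposed := hm.exposed

theorem storesInstance_setPair_one (hm : StoresInstance m (H.deleteEdges {s(a, b)}) N)
    (hab : H.Adj a b) (ha : m x 0 0 = a) (hb : m y 0 0 = b) :
    StoresInstance ((setPair 1).den m) H N where
  size := by rw [den_of_notMem_writes _ _ (by decide), hm.size]
  current k l := by
    have hkl := hm.current k l
    rw [SimpleGraph.deleteEdges_adj, Set.mem_singleton_iff] at hkl
    rw [setPair_current ha hb, ← SimpleGraph.mem_edgeSet]
    split_ifs with h
    · exact iff_of_true one_ne_zero (h ▸ hab)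
    · exact hkl.trans (and_iff_left h)
  mate := by
    rw [den_of_notMem_writes _ _ (by decide)]
    exact hm.mate
  isMate := ⟨hm.isMate.mate_mate, fun z hz => SimpleGraph.deleteEdges_le _ (hm.isMate.adj z hz)⟩
  exposed := hm.exposed

/-- The program which deletes the edge `x y` from the current graph, unless it is in the stored
matching or in every perfect matching. -/
def deleteIfSpare : ForProg :=
  when (and (read current (var x) (var y)) (ne (entry mate (var x)) (var y)))
    (setPair 0 ;; decideMatchable ;; when (not (var found)) (setPair 1))

theorem exists_storesInstance_deleteIfSpare {H' : SimpleGraph (Fin n)} {S : Set (Fin n × Fin n)}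
    (hm : StoresInstance m H' N) (hH : IsSwept H N S H') (ha : m x 0 0 = a) (hb : m y 0 0 = b) :
    ∃ H'', StoresInstance (deleteIfSpare.den m) H'' N ∧ IsSwept H N (insert (a, b) S) H'' := by
  by_cases hab : H'.Adj a b ∧ N a ≠ b
  · have hdelete := storesInstance_setPair_zero hm hab.2 ha hb
    have hfound := decideMatchable_ne_zero_iff hdelete
    set m₁ := decideMatchable.den ((setPair 0).den m) with hm₁
    replace hdelete := storesInstance_congr (m' := m₁) hdelete fun c hc =>
      den_of_notMem_writes _ _ (by revert c; decide)
    have hden : deleteIfSpare.den m = (when (not (var found)) (setPair 1)).den m₁ :=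
      if_pos (by simpa [eval, ha, hb, hm.current a b, hm.mate a, Fin.val_inj] using hab)
    rw [hden]
    by_cases hmatchable : Matchable (H'.deleteEdges {s(a, b)}) Set.univ
    · have hdone : (when (not (var found)) (setPair 1)).den m₁ = m₁ :=
        if_neg (by simpa [eval] using hfound.2 hmatchable)
      rw [hdone]
      exact ⟨_, hdelete, hH.delete hab.2 hmatchable⟩
    · have hundo : (when (not (var found)) (setPair 1)).den m₁ = (setPair 1).den m₁ :=
        if_pos (by simpa [eval] using hfound.not.2 hmatchable)
      rw [hundo]
      refine ⟨H', storesInstance_setPair_one hdelete hab.1 ?_ ?_, hH.keep fun _ _ => hmatchable⟩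
      all_goals rw [hm₁, den_of_notMem_writes _ _ (by decide), den_of_notMem_writes _ _ (by decide)]
      exacts [ha, hb]
  · have hden : deleteIfSpare.den m = m :=
      if_neg (by simpa [eval, ha, hb, hm.current a b, hm.mate a, Fin.val_inj] using hab)
    rw [hden]
    exact ⟨H', hm, hH.keep fun hadj hne => absurd ⟨hadj, hne⟩ hab⟩

/-- The program which thins out the current graph such that all remaining edges outside the stored
matching are in every perfect matching, and then replaces the stored matching by a perfect one. -/
def rematch : ForProg :=
  loop x 0 (loop y 0 deleteIfSpare) ;;
  update i oldMate (lit 1) (entry mate (var i)) ;;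
  overwrite i j mate (and (read current (var i) (var j)) (ne (entry oldMate (var i)) (var j)))
    (var j)

theorem exists_storesInstance_sweep (hm : StoresInstance m H N) (hH : Matchable H Set.univ) :
    ∃ H', StoresInstance ((loop x 0 (loop y 0 deleteIfSpare)).den m) H' N ∧
      IsSwept H N Set.univ H' := by
  refine forEachPair_rule (fun S s => ∃ H', StoresInstance s H' N ∧ IsSwept H N S H') hm.size
    (by decide) (fun S s v ⟨H', hs, hH'⟩ => ?_) ⟨H, hm, .start hm.isMate hH⟩
    fun S a b s _ ⟨H', hs, hH'⟩ ha hb _ => exists_storesInstance_deleteIfSpare hs hH' ha hb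
  constructor
  all_goals exact ⟨H', storesInstance_congr hs fun c hc =>
    Memory.write_of_ne _ _ _ _ (by revert c; decide), hH'⟩

theorem exists_storesMap_rematch (hm : StoresInstance m H N) (hH : Matchable H Set.univ) :
    ∃ f, IsPairing H f Set.univ ∧ StoresMap (rematch.den m mate) fun x => (f x : ℕ) := by
  obtain ⟨H', hm', hH'⟩ := exists_storesInstance_sweep hm hH
  obtain ⟨f, hf, hforced⟩ := hH'.exists_isPairing
  refine ⟨f, hf, fun k => ?_⟩
  set m₁ := (loop x 0 (loop y 0 deleteIfSpare)).den m
  have hold : StoresMap ((update i oldMate (lit 1) (entry mate (var i))).den m₁ oldMate)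
      fun x => (N x : ℕ) := storesMap_update hm'.size (by decide) fun k s hs hk _ => by
    simp [eval, hk, hs, hm'.mate k]
  have hrule := overwrite_rule (x := i) (y := j) (a := mate)
    (m := (update i oldMate (lit 1) (entry mate (var i))).den m₁)
    (g := and (read current (var i) (var j)) (ne (entry oldMate (var i)) (var j))) (e := var j)
    (fun k l => H'.Adj k l ∧ N k ≠ l) (fun k => f k) ?_ (by decide) ?_ k
  · have hmate : (update i oldMate (lit 1) (entry mate (var i))).den m₁ mate 0 k = N k := by
      rw [den_of_notMem_writes _ _ (by decide), hm'.mate k]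
    change (overwrite _ _ _ _ _).den _ _ _ _ = _
    by_cases h : ∃ l, H'.Adj k l ∧ N k ≠ l
    · exact hrule.1 _ h.choose_spec
    · rw [hrule.2 (not_exists.1 h), hmate]
      exact congrArg _ ((hforced k).2 (by grind)).symm
  · rw [den_of_notMem_writes _ _ (by decide), hm'.size]
  · intro k l s hs hk hl
    have hcurrent : s current = m₁ current := by
      rw [hs _ (by decide), den_of_notMem_writes _ _ (by decide)]
    have holdMate := hold k
    rw [← hs oldMate (by decide)] at holdMate
    refine ⟨?_, fun h => ?_⟩
    · simp [eval, hk, hl, hcurrent, hm'.current k l, holdMate, Fin.val_inj]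
    · rw [(hforced k).1 l h.1 h.2]
      exact hl

/-- The program which removes the edge at `r` from the stored matching. -/
def exposeAt : ForProg :=
  set spare (entry mate (var r)) ;; assign mate (lit 0) (var spare) (var spare) ;;
    assign mate (lit 0) (var r) (var r)

theorem storesMap_exposeAt (hN : StoresMap (m mate) fun x => (N x : ℕ)) (ha : m r 0 0 = a) :
    StoresMap (exposeAt.den m mate) fun x => (exposing N a x).val := fun k => by
  have hden : exposeAt.den m mate 0 k = if k = a then a else if k = N a then N a else N k := by
    simp [exposeAt, den, eval, ha, hN a, hN k, Fin.val_inj, apply_ite Fin.val]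
  rw [hden]
  grind [exposing]

/-- The program which removes the edge at `r` from the stored matching and installs the exchange
graph. -/
def startExchange : ForProg :=
  exposeAt ;; table i j current (or (read target (var i) (var j)) (and (ne (var i) (var j))
    (or (eq (entry mate (var i)) (var j)) (eq (entry mate (var j)) (var i)))))

theorem storesInstance_startExchange (hn : m 0 0 0 = n) (hT : StoresGraph (m target) T)
    (hN : StoresMap (m mate) fun x => (N x).val) (hpair : IsPairing ⊤ N Set.univ)
    (ha : m r 0 0 = a) :
    StoresInstance (startExchange.den m) (exchangeGraph T N a) (exposing N a) := by
  have hne : ∀ x, N x ≠ x := fun x => (hpair x trivial).2.2.ne'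
  have hN₁ : StoresMap (exposeAt.den m mate) fun x => (exposing N a x).val :=
    storesMap_exposeAt hN ha
  refine ⟨?_, ?_, ?_, isMate_exposing fun x => (hpair x trivial).2.1,
    a, N a, (hne a).symm, fun x => exposing_eq_self_iff hne⟩
  · rw [den_of_notMem_writes _ _ (by decide), hn]
  · refine storesGraph_table (by rw [den_of_notMem_writes _ _ (by decide), hn]) (by decide)
      fun k l s hs hk hl => ?_
    have hmate : s mate = exposeAt.den m mate := hs _ (by decide)
    have htarget : s target = m target := by
      rw [hs _ (by decide), den_of_notMem_writes _ _ (by decide)]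
    simp [eval, hk, hl, hmate, htarget, hT k l, hN₁ k, hN₁ l, exchangeGraph_adj, Fin.val_inj]
  · change StoresMap ((table _ _ _ _).den (exposeAt.den m) _) _
    rwa [den_of_notMem_writes _ _ (by decide)]

/-- The program which turns the stored perfect matching of the complete graph into one which has an
edge of the target graph at `r`, if the target graph has a perfect matching. -/
def exchangeAt : ForProg :=
  when (not (read target (var r) (entry mate (var r)))) (startExchange ;; rematch)

/-- The memory contains the graph `T`, and a perfect matching of the complete graph which has an
edge of `T` at each vertex in `S`. -/
structure StoresPartial (m : Memory) (T : SimpleGraph (Fin n)) (S : Set (Fin n)) : Prop where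
  size : m 0 0 0 = n
  target : StoresGraph (m target) T
  mate : ∃ N, StoresMap (m mate) (fun x => (N x).val) ∧ IsPairing ⊤ N Set.univ ∧
    ∀ x ∈ S, T.Adj x (N x)

theorem storesPartial_congr {m' : Memory} {S : Set (Fin n)} (h : StoresPartial m T S)
    (hm : ∀ c ∈ [0, target, mate], m' c = m c) : StoresPartial m' T S := by
  simp only [List.forall_mem_cons] at hm
  obtain ⟨h₁, h₂, h₃, -⟩ := hm
  exact ⟨h₁ ▸ h.size, h₂ ▸ h.target, h₃ ▸ h.mate⟩

theorem storesPartial_exchangeAt {S : Set (Fin n)} (hm : StoresPartial m T S)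
    (hT : Matchable T Set.univ) (ha : m r 0 0 = a) :
    StoresPartial (exchangeAt.den m) T (insert a S) := by
  obtain ⟨N, hN, hpair, hS⟩ := hm.mate
  refine ⟨?_, ?_, ?_⟩
  · rw [den_of_notMem_writes _ _ (by decide), hm.size]
  · rw [den_of_notMem_writes _ _ (by decide)]
    exact hm.target
  by_cases hadj : T.Adj a (N a)
  · have hden : exchangeAt.den m = m :=
      if_neg (by simpa [eval, ha, hN a, hm.target a (N a)] using hadj)
    rw [hden]
    exact ⟨N, hN, hpair, fun x hx => hx.elim (fun h => h ▸ hadj) (hS x)⟩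
  · have hden : exchangeAt.den m = rematch.den (startExchange.den m) :=
      if_pos (by simpa [eval, ha, hN a, hm.target a (N a)] using hadj)
    obtain ⟨f, hf, hf'⟩ := exists_storesMap_rematch
      (storesInstance_startExchange hm.size hm.target hN hpair ha) (matchable_exchangeGraph hT)
    rw [hden]
    exact ⟨f, hf', fun x hx => ⟨hx, (hf x hx).2.1, (hf x hx).2.2.ne⟩, fun x hx =>
      adj_of_isPairing_exchangeGraph (fun x => (hpair x trivial).2.1) hf (hx.imp_right (hS x))⟩

/-- The program which turns the stored perfect matching of the complete graph into a perfect
matching of the target graph, if there is one. -/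
def convert : ForProg :=
  loop r 0 exchangeAt

theorem exists_storesMap_convert (hn : m 0 0 0 = n) (hT : StoresGraph (m target) T)
    (hmatchable : Matchable T Set.univ) (hN : StoresMap (m mate) fun x => (N x).val)
    (hpair : IsPairing ⊤ N Set.univ) :
    ∃ f, IsPairing T f Set.univ ∧ StoresMap (convert.den m mate) fun x => (f x).val := by
  have h := forEach_rule (x := r) (p := exchangeAt) (fun S s => StoresPartial s T S) hn
    (fun S s v h => storesPartial_congr h fun c hc =>
      Memory.write_of_ne _ _ _ _ (by revert c; decide))
    ⟨hn, hT, N, hN, hpair, fun _ h => h.elim⟩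
    fun S a s _ h ha _ => storesPartial_exchangeAt h hmatchable ha
  obtain ⟨f, hf, hpair, hadj⟩ := h.mate
  exact ⟨f, fun x hx => ⟨hx, (hpair x hx).2.1, hadj x hx⟩, hf⟩

end Exchange

section Attempt

variable {n L : ℕ} {G : SimpleGraph (Fin n)} {C : G.EdgeLabeling Color} {M M' : G.Subgraph} {k : ℕ}
  {m m' : Memory} {c : Color} {E : Set (Sym2 (Fin n))} {f : Fin n → Fin n}

theorem matrixArray_apply (r : Fin n → Fin n → Prop) [DecidableRel r] (a b : Fin n) :
    matrixArray r a b = if r a b then 1 else 0 := by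
  split_ifs with h
  · exact if_pos ⟨a, b, rfl, rfl, h⟩
  · refine if_neg fun ⟨a', b', ha, hb, h'⟩ => h ?_
    rwa [← Fin.ext ha, ← Fin.ext hb]

theorem matrixArray_ne_zero {r : Fin n → Fin n → Prop} {a b : Fin n} :
    matrixArray r a b ≠ 0 ↔ r a b := by
  classical simp [matrixArray_apply]

theorem exists_of_matrixArray_ne_zero {r : Fin n → Fin n → Prop} {i j : ℕ}
    (h : matrixArray r i j ≠ 0) : ∃ b : Fin n, (b : ℕ) = j := by
  obtain ⟨-, b, -, hb, -⟩ := of_not_not (mt (if_neg ·) h)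
  exact ⟨b, hb⟩

theorem sum_matrixArray (r : Fin n → Fin n → Prop) (f : Fin n → Fin n) :
    ∑ x : Fin n, matrixArray r x (f x) = {x | r x (f x)}.ncard := by
  classical
  simp only [matrixArray_apply, Set.ncard_eq_toFinset_card', Set.toFinset_ofPred,
    Finset.card_filter]

/-- The memory contains the input of the algorithm, together with the number `L + L` of digits of a
guess. -/
structure StoresInput (m : Memory) (C : G.EdgeLabeling Color) (M : G.Subgraph) (k L : ℕ) :
    Prop where
  size : m 0 0 0 = n
  count : m 0 0 1 = k
  budget : m 0 0 2 = L
  length : m 0 0 4 = L + L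
  graph : m graph = matrixArray G.Adj
  red : m red = matrixArray (C.labelGraph .red).Adj
  matching : m matching = matrixArray M.Adj

theorem storesInput_congr (h : StoresInput m C M k L)
    (hm : ∀ c ∈ [0, graph, red, matching], m' c = m c) : StoresInput m' C M k L := by
  simp only [List.forall_mem_cons] at hm
  obtain ⟨h₁, h₂, h₃, h₄, -⟩ := hm
  exact ⟨h₁ ▸ h.size, h₁ ▸ h.count, h₁ ▸ h.budget, h₁ ▸ h.length, h₂ ▸ h.graph, h₃ ▸ h.red,
    h₄ ▸ h.matching⟩

/-- The output array contains a perfect matching with `k` red edges. -/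
def Solved (C : G.EdgeLabeling Color) (k : ℕ) (m : Memory) : Prop :=
  ∃ M : G.Subgraph, M.IsPerfectMatching ∧ redCount C M = k ∧ Outputs m M

theorem solved_congr (h : Solved C k m) (hm : m' output = m output) : Solved C k m' := by
  obtain ⟨M, hM, hk, hout⟩ := h
  exact ⟨M, hM, hk, fun u v => (congrFun₂ hm u v).trans (hout u v)⟩

/-- The program which counts the vertices at which the stored map is not a pairing of the graph. -/
def countDefects : ForProg :=
  sum i defects (not (and (read graph (var i) (entry mate (var i)))
    (eq (entry mate (entry mate (var i))) (var i))))

theorem countDefects_eq_zero_iff (hm : StoresInput m C M k L) :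
    countDefects.den m defects 0 0 = 0 ↔
      ∃ f : Fin n → Fin n, IsPairing G f Set.univ ∧ StoresMap (m mate) fun x => (f x).val := by
  rw [countDefects, sum_rule (fun a => if m graph a (m mate 0 a) ≠ 0 ∧
    m mate 0 (m mate 0 a) = a then 0 else 1) hm.size (by decide) (by decide) fun a s hs ha => by
      simp [eval, ha, hs]]
  simp only [Finset.sum_eq_zero_iff, Finset.mem_univ, true_imp_iff, ite_eq_left_iff, one_ne_zero,
    imp_false, not_not, hm.graph]
  constructor
  · intro h
    choose f hf using fun a => exists_of_matrixArray_ne_zero (h a).1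
    refine ⟨f, fun a _ => ?_, fun a => (hf a).symm⟩
    obtain ⟨hadj, hinv⟩ := h a
    rw [← hf a, matrixArray_ne_zero] at hadj
    rw [← hf a, ← hf, Fin.val_inj] at hinv
    exact ⟨trivial, hinv, hadj⟩
  · rintro ⟨f, hf, hmate⟩ a
    have hmate : ∀ a : Fin n, m mate 0 a = f a := hmate
    rw [hmate a, hmate (f a), (hf a trivial).2.1]
    exact ⟨matrixArray_ne_zero.2 (hf a trivial).2.2, rfl⟩

/-- The program which counts the vertices whose edge in the stored pairing is red. -/
def countRed : ForProg :=
  sum i reds (read red (var i) (entry mate (var i)))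

theorem countRed_eq (hm : StoresInput m C M k L) (hf : StoresMap (m mate) fun x => (f x).val) :
    countRed.den m reds 0 0 = {x | (C.labelGraph .red).Adj x (f x)}.ncard := by
  rw [← sum_matrixArray]
  exact sum_rule _ hm.size (by decide) (by decide) fun a s hs ha => by
    simp [eval, ha, hs, hm.red, hf a]

/-- Row `0` of the array `A` contains a perfect matching with `k` red edges. -/
def StoresSolution (A : ℕ → ℕ → ℕ) (C : G.EdgeLabeling Color) (k : ℕ) : Prop :=
  ∃ f : Fin n → Fin n, IsPairing G f Set.univ ∧ StoresMap A (fun x => (f x).val) ∧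
    {x | (C.labelGraph .red).Adj x (f x)}.ncard = 2 * k

/-- The test whether there are no defects and `2 * k` red vertices. -/
def checksPass : Expr :=
  and (not (var defects)) (eq (var reds) (add (read 0 (lit 0) (lit 1)) (read 0 (lit 0) (lit 1))))

theorem holds_checksPass (hm : StoresInput m C M k L) :
    checksPass.Holds (countRed.den (countDefects.den m)) ↔ StoresSolution (m mate) C k := by
  have hdefects := countDefects_eq_zero_iff hm
  set m₁ := countDefects.den m with hm₁
  have hinput : StoresInput m₁ C M k L := storesInput_congr hm fun c hc =>
    den_of_notMem_writes _ _ (by revert c; decide)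
  have hreds : ∀ f : Fin n → Fin n, StoresMap (m mate) (fun x => (f x).val) →
      countRed.den m₁ reds 0 0 = {x | (C.labelGraph .red).Adj x (f x)}.ncard := fun f hf =>
    countRed_eq hinput (by rwa [hm₁, den_of_notMem_writes _ _ (by decide)])
  have hzero : countRed.den m₁ defects 0 0 = m₁ defects 0 0 := by
    rw [den_of_notMem_writes _ _ (by decide)]
  have hcount : countRed.den m₁ 0 0 1 = k := by
    rw [den_of_notMem_writes _ _ (by decide), hinput.count]
  simp only [checksPass, holds_and, holds_not, holds_read, holds_eq, eval, not_not, hzero, hcount,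
    hdefects, ← two_mul]
  constructor
  · rintro ⟨⟨f, hf, hfm⟩, h⟩
    exact ⟨f, hf, hfm, hreds f hfm ▸ h⟩
  · rintro ⟨f, hf, hfm, h⟩
    exact ⟨⟨f, hf, hfm⟩, (hreds f hfm).trans h⟩

/-- The program which outputs the stored map if it is a perfect matching with `k` red edges. -/
def emit : ForProg :=
  countDefects ;; countRed ;; when checksPass (table i j output (eq (entry mate (var i)) (var j)))

theorem solved_emit (hm : StoresInput m C M k L) (h : Solved C k m ∨ StoresSolution (m mate) C k) :
    Solved C k (emit.den m) := by
  have htest := holds_checksPass hm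
  set m₂ := countRed.den (countDefects.den m) with hm₂
  have hframe : ∀ c ∉ [i, defects, reds], m₂ c = m c := fun c hc => by
    rw [hm₂, den_of_notMem_writes _ _ (by grind [countRed, sum, writes]),
      den_of_notMem_writes _ _ (by grind [countDefects, sum, writes])]
  by_cases hf : StoresSolution (m mate) C k
  · have hden : emit.den m = (table i j output (eq (entry mate (var i)) (var j))).den m₂ :=
      if_pos (htest.2 hf)
    obtain ⟨f, hf, hfm, hcount⟩ := hf
    obtain ⟨M, hM, hMf⟩ := hf.exists_isPerfectMatching
    rw [ncard_red_adj_eq_two_mul_redCount hMf] at hcount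
    refine ⟨M, hM, by omega, fun a b => ?_⟩
    obtain ⟨s, hs, ha, hb, hout⟩ := table_rule (x := i) (y := j) (a := output) (m := m₂)
      (e := eq (entry mate (var i)) (var j)) (n := n) (by rw [hframe _ (by decide), hm.size])
      (by decide) a b
    have hmate : s mate 0 a = f a := by rw [hs _ (by decide), hframe _ (by decide), hfm a]
    classical
    rw [hden, hout, matrixArray_apply, eval_eq]
    simp only [eval, ha, hb, hmate, hMf, Fin.val_inj]
  · have hden : emit.den m = m₂ := if_neg (htest.not.2 hf)
    rw [hden]
    exact solved_congr (h.resolve_right hf) (hframe _ (by decide))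

variable {a b : Fin n}

/-- The test whether the pair `i j` is an edge of colour `c`. -/
def colourTest : Color → Expr
  | .red => read red (var i) (var j)
  | .blue => and (read graph (var i) (var j)) (not (read red (var i) (var j)))

theorem holds_colourTest (hm : StoresInput m C M k L) (ha : m i 0 0 = a) (hb : m j 0 0 = b) :
    (colourTest c).Holds m ↔ (C.labelGraph c).Adj a b := by
  have hred : m red a b ≠ 0 ↔ (C.labelGraph .red).Adj a b := by rw [hm.red, matrixArray_ne_zero]
  have hgraph : m graph a b ≠ 0 ↔ G.Adj a b := by rw [hm.graph, matrixArray_ne_zero]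
  cases c with
  | red => simpa only [colourTest, holds_read, eval, ha, hb] using hred
  | blue =>
    rw [labelGraph_blue_adj, ← hred, ← hgraph]
    simp only [colourTest, holds_and, holds_not, holds_read, eval, ha, hb]

/-- The program which installs the graph `forcedGraph C c M E`, where `E` is the stored list of
edges. -/
def installForced (c : Color) : ForProg :=
  table i j forced (and (colourTest c)
    (or (and (read matching (var i) (var j)) (not (read listed (var i) (var j))))
      (and (not (read matching (var i) (var j))) (read listed (var i) (var j)))))

theorem storesGraph_installForced (hm : StoresInput m C M k L)
    (hE : ∀ x y : Fin n, m listed x y ≠ 0 ↔ s(x, y) ∈ E) :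
    StoresGraph ((installForced c).den m forced) (forcedGraph C c M E) := by
  refine storesGraph_table hm.size (by decide) fun a b s hs ha hb => ?_
  have hs' : StoresInput s C M k L := storesInput_congr hm fun c hc => hs c (by revert c; decide)
  have hmatching : s matching a b ≠ 0 ↔ M.Adj a b := by rw [hs'.matching, matrixArray_ne_zero]
  have hlisted : s listed a b ≠ 0 ↔ s(a, b) ∈ E := by rw [hs _ (by decide), hE]
  simp only [holds_and, holds_colourTest hs' ha hb, holds_or, holds_not, holds_read, eval, ha, hb,
    hmatching, hlisted, forcedGraph_adj]
  tauto

/-- The program which marks the vertices covered by the stored forced edges. -/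
def markCovered : ForProg :=
  update i covered (lit 1) (lit 0) ;; overwrite i j covered (read forced (var i) (var j)) (lit 1)

theorem storesSet_markCovered {F : SimpleGraph (Fin n)} (hn : m 0 0 0 = n)
    (hF : StoresGraph (m forced) F) :
    StoresSet (markCovered.den m covered) {x | ∃ y, F.Adj x y} := fun a => by
  have hclear : StoresMap ((update i covered (lit 1) (lit 0)).den m covered) fun _ : Fin n => 0 :=
    storesMap_update hn (by decide) fun _ _ _ _ _ => ⟨fun _ => rfl, fun h => absurd one_ne_zero h⟩
  have hrule := overwrite_rule (x := i) (y := j) (a := covered) (e := lit 1)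
    (m := (update i covered (lit 1) (lit 0)).den m) (g := read forced (var i) (var j)) F.Adj
    (fun _ => 1) (by rw [den_of_notMem_writes _ _ (by decide), hn]) (by decide)
    (fun a b s hs ha hb => ⟨by
      rw [holds_read, eval, eval, eval, eval, ha, hb, hs _ (by decide),
        den_of_notMem_writes _ _ (by decide), hF a b], fun _ => rfl⟩) a
  change (overwrite _ _ _ _ _).den _ _ _ _ ≠ 0 ↔ ∃ y, F.Adj a y
  by_cases h : ∃ y, F.Adj a y
  · exact iff_of_true (by rw [hrule.1 _ h.choose_spec]; exact one_ne_zero) h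
  · exact iff_of_false (by rw [hrule.2 (not_exists.1 h), hclear a, not_not]) h

/-- The program which installs the completion of the stored forced edges. -/
def installCompletion (c : Color) : ForProg :=
  table i j target (or (read forced (var i) (var j))
    (and (and (read graph (var i) (var j)) (not (colourTest c)))
      (and (not (entry covered (var i))) (not (entry covered (var j))))))

theorem storesGraph_installCompletion {F : SimpleGraph (Fin n)} (hm : StoresInput m C M k L)
    (hF : StoresGraph (m forced) F) (hcovered : StoresSet (m covered) {x | ∃ y, F.Adj x y}) :
    StoresGraph ((installCompletion c).den m target) (completion G (C.labelGraph c) F) := by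
  refine storesGraph_table hm.size (by decide) fun a b s hs ha hb => ?_
  have hs' : StoresInput s C M k L := storesInput_congr hm fun c hc => hs c (by revert c; decide)
  have hgraph : s graph a b ≠ 0 ↔ G.Adj a b := by rw [hs'.graph, matrixArray_ne_zero]
  have hforced : s forced a b ≠ 0 ↔ F.Adj a b := by rw [hs _ (by decide), hF a b]
  have hcovered : ∀ a : Fin n, s covered 0 a ≠ 0 ↔ ∃ y, F.Adj a y := fun a => by
    rw [hs _ (by decide), hcovered a]
    rfl
  simp only [holds_and, holds_colourTest hs' ha hb, holds_or, holds_not, holds_read, eval, ha, hb,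
    hgraph, hforced, hcovered, completion, not_exists, and_assoc]

/-- The program which installs the graph whose perfect matchings are consistent with the stored list
of edges. -/
def installTarget (c : Color) : ForProg :=
  installForced c ;; markCovered ;; installCompletion c

theorem storesGraph_installTarget (hm : StoresInput m C M k L)
    (hE : ∀ x y : Fin n, m listed x y ≠ 0 ↔ s(x, y) ∈ E) :
    StoresGraph ((installTarget c).den m target)
      (completion G (C.labelGraph c) (forcedGraph C c M E)) := by
  have hforced := storesGraph_installForced (c := c) hm hE
  set m₁ := (installForced c).den m with hm₁
  have hm₁' : StoresInput m₁ C M k L := storesInput_congr hm fun d hd =>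
    den_of_notMem_writes _ _ (by revert d; cases c <;> decide)
  refine storesGraph_installCompletion (m := markCovered.den m₁) (storesInput_congr hm₁' fun d hd =>
    den_of_notMem_writes _ _ (by revert d; decide)) ?_ (storesSet_markCovered hm₁'.size hforced)
  rwa [den_of_notMem_writes _ _ (by decide)]

/-- The program which installs the partners of the vertices in the input matching. -/
def installMatching : ForProg :=
  overwrite i j mate (read matching (var i) (var j)) (var j)

theorem storesMap_installMatching {f : Fin n → Fin n} (hm : StoresInput m C M k L)
    (hf : ∀ x y, M.Adj x y ↔ f x = y) :
    StoresMap (installMatching.den m mate) fun x => (f x).val := fun a =>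
  (overwrite_rule (fun a b => f a = b) (fun x => (f x).val) hm.size (by decide)
    (fun a b s hs ha hb => ⟨by
      rw [holds_read, eval, eval, eval, eval, ha, hb, hs _ (by decide), hm.matching,
        matrixArray_ne_zero, hf], fun h => by rw [h]; exact hb⟩) a).1 _ rfl

/-- The program which searches for a perfect matching whose symmetric difference with the input
matching has the same edges of colour `c` as the stored list, and outputs it if it has `k` red
edges. -/
def attempt (c : Color) : ForProg :=
  installTarget c ;; installMatching ;; convert ;; emit

theorem solved_attempt (hm : StoresInput m C M k L) (hM : M.IsPerfectMatching)
    (hE : ∀ x y : Fin n, m listed x y ≠ 0 ↔ s(x, y) ∈ E)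
    (h : Solved C k m ∨ ∃ M' : G.Subgraph, M'.IsPerfectMatching ∧ redCount C M' = k ∧
      ofColor C c E = ofColor C c (symmDiff M.edgeSet M'.edgeSet)) :
    Solved C k ((attempt c).den m) := by
  have hT := storesGraph_installTarget (c := c) hm hE
  set m₁ := (installTarget c).den m with hm₁
  have hm₁' : StoresInput m₁ C M k L := storesInput_congr hm fun d hd =>
    den_of_notMem_writes _ _ (by revert d; cases c <;> decide)
  set m₂ := installMatching.den m₁ with hm₂
  refine solved_emit (m := convert.den m₂) (storesInput_congr hm₁' fun d hd => ?_) ?_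
  · rw [den_of_notMem_writes _ _ (by revert d; decide), hm₂,
      den_of_notMem_writes _ _ (by revert d; decide)]
  refine h.imp (fun h => solved_congr h ?_) fun ⟨M', hM', hk, hEM⟩ => ?_
  · rw [den_of_notMem_writes _ _ (by decide), hm₂, den_of_notMem_writes _ _ (by decide), hm₁,
      den_of_notMem_writes _ _ (by cases c <;> decide)]
  · obtain ⟨N, hN, hMN⟩ := exists_isPairing_of_isPerfectMatching hM
    obtain ⟨g, hg, hgm⟩ := exists_storesMap_convert (m := m₂) (N := N)
      (by rw [hm₂, den_of_notMem_writes _ _ (by decide), hm₁'.size])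
      (by rwa [hm₂, den_of_notMem_writes _ _ (by decide)]) (matchable_completion hM' hEM)
      (storesMap_installMatching hm₁' hMN)
      fun x hx => ⟨hx, (hN x hx).2.1, (hN x hx).2.2.ne⟩
    obtain ⟨hgG, hred⟩ := ncard_red_adj_of_isPairing_completion hM' hEM hg
    exact ⟨g, hgG, hgm, hk ▸ hred⟩

end Attempt

section Enumeration

variable {n L : ℕ} {G : SimpleGraph (Fin n)} {C : G.EdgeLabeling Color} {M : G.Subgraph} {k : ℕ}
  {m : Memory}

/-- The program which adds the edge whose ends are the digits number `t` and `L + t` of the guess to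
the list of edges, where `t` is the content of `step`. -/
def listEdge : ForProg :=
  assign listed (entry digit (var step)) (entry digit (add (read 0 (lit 0) (lit 2)) (var step)))
    (lit 1) ;;
  assign listed (entry digit (add (read 0 (lit 0) (lit 2)) (var step))) (entry digit (var step))
    (lit 1)

theorem listed_listEdge {p q : Fin n} {t : ℕ} (hL : m 0 0 2 = L) (ht : m step 0 0 = t)
    (hp : m digit 0 t = p) (hq : m digit 0 (L + t) = q) (a b : Fin n) :
    listEdge.den m listed a b = if s(p, q) = s(a, b) then 1 else m listed a b := by
  have hden : listEdge.den m = (m.write listed p q 1).write listed q p 1 := by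
    simp [listEdge, den, eval, hL, ht, hp, hq]
  simp only [hden, Memory.write_apply_same, Fin.val_inj, Sym2.eq_iff]
  grind

/-- The program which decodes the digits of the guess into a list of edges. -/
def listEdges : ForProg :=
  table i j listed (lit 0) ;; loop step 2 listEdge

theorem listed_listEdges {D : Fin (L + L) → Fin n} (hn : m 0 0 0 = n) (hL : m 0 0 2 = L)
    (hD : ∀ e : Fin (L + L), m digit 0 e = D e) (a b : Fin n) :
    listEdges.den m listed a b ≠ 0 ↔ s(a, b) ∈ guessedEdges D := by
  have hclear : (table i j listed (lit 0)).den m listed a b = 0 :=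
    (table_rule hn (by decide) a b).elim fun _ h => h.2.2.2
  have hloop := loop_rule (x := step) (j := 2) (b := L) (p := listEdge)
    (m := (table i j listed (lit 0)).den m)
    (fun t s => s listed a b ≠ 0 ↔
      ∃ e : Fin L, (e : ℕ) < t ∧ s(D (e.castAdd L), D (e.natAdd L)) = s(a, b))
    (by rw [den_of_notMem_writes _ _ (by decide), hL])
    (by simpa using hclear) fun t s ht hinv hs hframe => ?_
  · exact hloop.trans ⟨fun ⟨e, _, he⟩ => ⟨e, he⟩, fun ⟨e, he⟩ => ⟨e, e.2, he⟩⟩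
  · have hs' : ∀ c ∈ [0, digit], s c = m c := fun c hc => by
      rw [hframe c (by revert c; decide), den_of_notMem_writes _ _ (by revert c; decide)]
    have hlist := listed_listEdge (by rw [hs' 0 (by decide), hL]) hs
      (by rw [hs' digit (by decide)]; exact hD (Fin.castAdd L ⟨t, ht⟩))
      (by rw [hs' digit (by decide)]; exact hD (Fin.natAdd L ⟨t, ht⟩)) a b
    rw [Memory.write_of_ne _ _ _ _ (by decide), hlist]
    by_cases hab : s(D (Fin.castAdd L ⟨t, ht⟩), D (Fin.natAdd L ⟨t, ht⟩)) = s(a, b)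
    · refine iff_of_true ?_ ⟨⟨t, ht⟩, Nat.lt_succ_self t, hab⟩
      rw [if_pos hab]
      exact one_ne_zero
    · rw [if_neg hab, hinv]
      refine exists_congr fun e => and_congr_left fun he => ?_
      have het : (e : ℕ) ≠ t := by
        rintro rfl
        exact hab he
      omega

theorem div_mod_succ {N T v : ℕ} (hn : 0 < n) (hv : v = T / N % n + if N ∣ T + 1 then 1 else 0) :
    (T + 1) / N % n = (if v = n then 0 else v) ∧ (N * n ∣ T + 1 ↔ v = n) := by
  have hlt := Nat.mod_lt (T / N) hn
  by_cases hN : N ∣ T + 1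
  · have hmod : (T + 1) / N % n = if v = n then 0 else v := by
      rw [if_pos hN] at hv
      rw [Nat.succ_div, if_pos hN, ← Nat.mod_add_mod, ← hv]
      split_ifs with hvn
      · rw [hvn, Nat.mod_self]
      · exact Nat.mod_eq_of_lt (by omega)
    refine ⟨hmod, ?_⟩
    rw [← Nat.dvd_div_iff_mul_dvd hN, Nat.dvd_iff_mod_eq_zero, hmod, ite_eq_left_iff]
    rw [if_pos hN] at hv
    omega
  · rw [if_neg hN, Nat.add_zero] at hv
    rw [Nat.succ_div, if_neg hN, if_neg (by omega), Nat.add_zero, hv]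
    exact ⟨rfl, iff_of_false (fun h => hN (dvd_of_mul_right_dvd h)) (by omega)⟩

/-- The program which adds `carry` to the digit number `step`, and stores in `carry` whether that
digit overflows. -/
def incrementDigit : ForProg :=
  assign digit (lit 0) (var step) (add (entry digit (var step)) (var carry)) ;;
  ite (eq (entry digit (var step)) (read 0 (lit 0) (lit 0)))
    (assign digit (lit 0) (var step) (lit 0) ;; set carry (lit 1)) (set carry (lit 0))

theorem digit_incrementDigit {t v : ℕ} (hn : m 0 0 0 = n) (ht : m step 0 0 = t)
    (hv : m digit 0 t + m carry 0 0 = v) (e : ℕ) :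
    incrementDigit.den m digit 0 e =
      if e = t then if v = n then 0 else v else m digit 0 e := by
  simp only [incrementDigit, den]
  split_ifs <;> simp_all [eval]

theorem carry_incrementDigit {t v : ℕ} (hn : m 0 0 0 = n) (ht : m step 0 0 = t)
    (hv : m digit 0 t + m carry 0 0 = v) :
    incrementDigit.den m carry 0 0 = if v = n then 1 else 0 := by
  simp only [incrementDigit, den]
  split_ifs <;> simp_all [eval]

/-- The program which adds `1` to the number whose base `n` digits are stored. -/
def increment : ForProg :=
  set carry (lit 1) ;; loop step 4 incrementDigit

theorem digit_increment {K T : ℕ} (hn : m 0 0 0 = n) (hpos : 0 < n) (hK : m 0 0 4 = K)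
    (hT : ∀ e < K, m digit 0 e = T / n ^ e % n) :
    ∀ e < K, increment.den m digit 0 e = (T + 1) / n ^ e % n := by
  have hloop := loop_rule (x := step) (j := 4) (b := K) (m := m.write carry 0 0 1)
    (p := incrementDigit)
    (fun t s => (∀ e < K, s digit 0 e = (if e < t then T + 1 else T) / n ^ e % n) ∧
      s carry 0 0 = if n ^ t ∣ T + 1 then 1 else 0) hK (by simpa using hT) ?_
  · exact fun e he => (hloop.1 e he).trans (by rw [if_pos he])
  · rintro t s ht ⟨hdigit, hcarry⟩ hs hframe
    have hsize : s 0 0 0 = n := by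
      rw [hframe _ (by decide), Memory.write_of_ne _ _ _ _ (by decide), hn]
    obtain ⟨hmod, hdvd⟩ := div_mod_succ hpos (v := s digit 0 t + s carry 0 0)
      (by rw [hdigit t ht, if_neg (lt_irrefl t), hcarry])
    refine ⟨fun e he => ?_, ?_⟩
    · rw [Memory.write_of_ne _ _ _ _ (by decide), digit_incrementDigit hsize hs rfl]
      obtain rfl | het := eq_or_ne e t
      · rw [if_pos rfl, if_pos (Nat.lt_succ_self e), hmod]
      · rw [if_neg het, hdigit e he]
        simp only [Nat.lt_succ_iff_lt_or_eq, het, or_false]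
    · rw [Memory.write_of_ne _ _ _ _ (by decide), carry_incrementDigit hsize hs rfl, pow_succ]
      exact (if_congr hdvd rfl rfl).symm

/-- The program which computes the number `n ^ K` of guesses, where `K` is the number of digits of a
guess, by repeated addition. -/
def power : ForProg :=
  set product (lit 1) ;; loop step 4 (sum i total (var product) ;; set product (var total))

theorem product_power {K : ℕ} (hn : m 0 0 0 = n) (hK : m 0 0 4 = K) :
    power.den m product 0 0 = n ^ K := by
  refine loop_rule (x := step) (p := sum i total (var product) ;; set product (var total))
    (fun t s => s product 0 0 = n ^ t) hK rfl fun t s _ hinv _ hframe => ?_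
  have htotal : (sum i total (var product)).den s total 0 0 = ∑ _ : Fin n, n ^ t := by
    refine sum_rule _ ?_ (by decide) (by decide) fun _ s' hs' _ => ?_
    · rw [hframe _ (by decide), den_of_notMem_writes _ _ (by decide), hn]
    · rw [eval, hs' _ (by decide) (by decide)]
      exact hinv
  simp [den, eval, htotal, pow_succ']

variable (C M k) in
/-- The guessed edges have, for one of the two colours, the same edges of that colour as the
symmetric difference of the input matching with a perfect matching with `k` red edges. -/
def IsGoodGuess (D : Fin (L + L) → Fin n) : Prop :=
  ∃ (c : Color) (M' : G.Subgraph), M'.IsPerfectMatching ∧ redCount C M' = k ∧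
    ofColor C c (guessedEdges D) = ofColor C c (symmDiff M.edgeSet M'.edgeSet)

/-- The program which tries to solve the problem under the assumption that the stored guess is
good. -/
def tryGuess : ForProg :=
  listEdges ;; attempt .red ;; attempt .blue

theorem solved_tryGuess {D : Fin (L + L) → Fin n} (hm : StoresInput m C M k L)
    (hM : M.IsPerfectMatching) (hD : ∀ e : Fin (L + L), m digit 0 e = D e)
    (h : Solved C k m ∨ IsGoodGuess C M k D) : Solved C k (tryGuess.den m) := by
  have hlisted := listed_listEdges hm.size hm.budget hD
  set m₁ := listEdges.den m
  have hm₁' : StoresInput m₁ C M k L := storesInput_congr hm fun d hd =>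
    den_of_notMem_writes _ _ (by revert d; decide)
  set m₂ := (attempt .red).den m₁ with hm₂
  have hm₂' : StoresInput m₂ C M k L := storesInput_congr hm₁' fun d hd =>
    den_of_notMem_writes _ _ (by revert d; decide)
  have hlisted₂ : ∀ a b : Fin n, m₂ listed a b ≠ 0 ↔ s(a, b) ∈ guessedEdges D := fun a b => by
    rw [hm₂, den_of_notMem_writes _ _ (by decide), hlisted]
  have hkeep : Solved C k m → Solved C k m₁ := fun h =>
    solved_congr h (den_of_notMem_writes _ _ (by decide))
  change Solved C k ((attempt .blue).den m₂)
  rcases h with h | ⟨c, hc⟩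
  · exact solved_attempt hm₂' hM hlisted₂ (.inl (solved_attempt hm₁' hM hlisted (.inl (hkeep h))))
  · cases c with
    | red => exact solved_attempt hm₂' hM hlisted₂ (.inl (solved_attempt hm₁' hM hlisted (.inr hc)))
    | blue => exact solved_attempt hm₂' hM hlisted₂ (.inr hc)

/-- The program which tries all guesses. -/
def tryGuesses : ForProg :=
  loop guess 3 (tryGuess ;; increment)

theorem solved_tryGuesses {D : Fin (L + L) → Fin n} (hm : StoresInput m C M k L)
    (hM : M.IsPerfectMatching) (hpos : 0 < n) (hguesses : m 0 0 3 = n ^ (L + L))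
    (hdigit : ∀ e, m digit 0 e = 0) (hD : IsGoodGuess C M k D) :
    Solved C k (tryGuesses.den m) := by
  have hloop := loop_rule (x := guess) (j := 3) (m := m) (p := tryGuess ;; increment)
    (fun T s => (∀ e < L + L, s digit 0 e = T / n ^ e % n) ∧
      ((finFunctionFinEquiv D : ℕ) < T → Solved C k s)) hguesses ?_ ?_
  · exact hloop.2 (finFunctionFinEquiv D).2
  · exact ⟨fun e _ => by simpa using hdigit e, fun h => absurd h (Nat.not_lt_zero _)⟩
  · rintro T s hT ⟨hdigits, hsolved⟩ - hframe
    have hs : StoresInput s C M k L := storesInput_congr hm fun d hd =>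
      hframe d (by revert d; decide)
    have hsolved' : (finFunctionFinEquiv D : ℕ) < T + 1 → Solved C k (tryGuess.den s) := by
      intro h
      refine solved_tryGuess (D := finFunctionFinEquiv.symm ⟨T, hT⟩) hs hM
        (fun e => ?_) ?_
      · rw [hdigits e e.2, finFunctionFinEquiv_symm_apply_val]
      rcases Nat.lt_succ_iff_lt_or_eq.1 h with h | h
      · exact .inl (hsolved h)
      · rw [show (⟨T, hT⟩ : Fin _) = finFunctionFinEquiv D from Fin.ext h.symm,
          Equiv.symm_apply_apply]
        exact .inr hD
    refine ⟨?_, fun h => solved_congr (hsolved' h) ?_⟩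
    · rw [Memory.write_of_ne _ _ _ _ (by decide), den]
      refine digit_increment (m := tryGuess.den s) ?_ hpos ?_ fun e he => ?_
      · rw [den_of_notMem_writes _ _ (by decide), hs.size]
      · rw [den_of_notMem_writes _ _ (by decide), hs.length]
      · rw [den_of_notMem_writes _ _ (by decide), hdigits e he]
    · rw [Memory.write_of_ne _ _ _ _ (by decide), den]
      exact den_of_notMem_writes _ _ (by decide)

/-- The program of the theorem.  It stores the number of digits and the number of guesses in the
cells `(0, 4)` and `(0, 3)` of array `0`, from which the loops read their bounds. -/
def algorithm : Prog :=
  .seq (.assign 0 (lit 0) (lit 4) (add (read 0 (lit 0) (lit 2)) (read 0 (lit 0) (lit 2))))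
    (.seq power.compile (.seq (.assign 0 (lit 0) (lit 3) (var product)) tryGuesses.compile))

/-- The memory of `algorithm` when the trial of the guesses starts. -/
def preparedMemory (m : Memory) : Memory :=
  (power.den (m.write 0 0 4 (m 0 0 2 + m 0 0 2))).write 0 0 3 (m 0 0 0 ^ (m 0 0 2 + m 0 0 2))

theorem preparedMemory_zero (m : Memory) (j : ℕ) :
    preparedMemory m 0 0 j = if j = 3 then m 0 0 0 ^ (m 0 0 2 + m 0 0 2)
      else if j = 4 then m 0 0 2 + m 0 0 2 else m 0 0 j := by
  rw [preparedMemory, Memory.write_apply_same, den_of_notMem_writes _ _ (by decide),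
    Memory.write_apply_same]
  simp only [true_and]

theorem preparedMemory_of_notMem {a : ℕ} (ha : a ∉ 0 :: power.writes) :
    preparedMemory m a = m a := by
  rw [List.mem_cons, not_or] at ha
  rw [preparedMemory, Memory.write_of_ne _ _ _ _ ha.1, den_of_notMem_writes _ _ ha.2,
    Memory.write_of_ne _ _ _ _ ha.1]

theorem exists_runs_algorithm_of_le : ∃ c, ∀ (m : Memory) (b : ℕ), m 0 0 0 ≤ b →
    m 0 0 2 + m 0 0 2 ≤ b → m 0 0 0 ^ (m 0 0 2 + m 0 0 2) ≤ b →
    ∃ t, Runs algorithm m t (tryGuesses.den (preparedMemory m)) ∧ t ≤ (b + 2) ^ c := by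
  obtain ⟨c, hc⟩ := exists_time_le power
  obtain ⟨d, hd⟩ := exists_time_le tryGuesses
  refine ⟨10 + (c + (6 + d + 1) + 1) + 1, fun m b hn hlength hguesses => ?_⟩
  set m₁ := m.write 0 0 4 (m 0 0 2 + m 0 0 2) with hm₁
  have hm₁' : ∀ j, m₁ 0 0 j = if j = 4 then m 0 0 2 + m 0 0 2 else m 0 0 j := by simp [hm₁]
  obtain ⟨s, hpower, hs⟩ := runs_compile (p := power) (b := b) (by decide) m₁ fun j hj => by
    have : j = 4 ∨ j = 0 := by revert j; decide
    rcases this with rfl | rfl <;> simpa [hm₁']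
  obtain ⟨t, htry, ht⟩ := runs_compile (p := tryGuesses) (b := b) (by decide)
    (preparedMemory m) fun j hj => by
      have : j = 0 ∨ j = 2 ∨ j = 3 ∨ j = 4 := by revert j; decide
      rcases this with rfl | rfl | rfl | rfl <;> rw [preparedMemory_zero] <;> grind
  have hassign := Runs.assign 0 (lit 0) (lit 3) (var product) (power.den m₁)
  simp only [eval, product_power (hm₁' 0) (hm₁' 4)] at hassign
  exact ⟨_, (Runs.assign ..).seq (hpower.seq (hassign.seq htry)), add_le_add_two_pow
    (le_add_two_pow b 10) (add_le_add_two_pow (hs.trans (hc b)) (add_le_add_two_pow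
      (le_add_two_pow b 6) (ht.trans (hd b))))⟩

theorem exists_runs_algorithm : ∃ c, ∀ (n : ℕ) (G : SimpleGraph (Fin n)) (C : G.EdgeLabeling Color)
    (M : G.Subgraph) (k L : ℕ), ∃ t, Runs algorithm (inputMemory G C M k L) t
      (tryGuesses.den (preparedMemory (inputMemory G C M k L))) ∧
      t ≤ (max n 2) ^ (c * max L 1) := by
  obtain ⟨c, hc⟩ := exists_runs_algorithm_of_le
  refine ⟨4 * c, fun n G C M k L => ?_⟩
  set N := max n 2
  set b := N ^ (2 * max L 1) with hb
  have hn : n ≤ b := (le_max_left n 2).trans (Nat.le_self_pow (by omega) N)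
  have hlength : L + L ≤ b :=
    calc L + L ≤ 2 * max L 1 := by omega
      _ ≤ 2 ^ (2 * max L 1) := Nat.lt_two_pow_self.le
      _ ≤ b := Nat.pow_le_pow_left (le_max_right n 2) _
  have hguesses : n ^ (L + L) ≤ b :=
    (Nat.pow_le_pow_left (le_max_left n 2) _).trans (Nat.pow_le_pow_right (by omega) (by omega))
  obtain ⟨t, hrun, ht⟩ := hc (inputMemory G C M k L) b hn hlength hguesses
  refine ⟨t, hrun, ht.trans ?_⟩
  have htwo : 2 ≤ b := (le_max_right n 2).trans (Nat.le_self_pow (by omega) N)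
  calc (b + 2) ^ c ≤ (b ^ 2) ^ c := Nat.pow_le_pow_left (by nlinarith) c
    _ = N ^ (4 * c * max L 1) := by rw [hb, ← pow_mul, ← pow_mul]; ring_nf

theorem storesInput_preparedMemory :
    StoresInput (preparedMemory (inputMemory G C M k L)) C M k L where
  size := preparedMemory_zero _ 0
  count := preparedMemory_zero _ 1
  budget := preparedMemory_zero _ 2
  length := preparedMemory_zero _ 4
  graph := preparedMemory_of_notMem (by decide)
  red := preparedMemory_of_notMem (by decide)
  matching := preparedMemory_of_notMem (by decide)

theorem solved_preparedMemory {M' : G.Subgraph} {c : Color} (hM : M.IsPerfectMatching)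
    (hM' : M'.IsPerfectMatching) (hk : redCount C M' = k)
    (hL : (ofColor C c (symmDiff M.edgeSet M'.edgeSet)).ncard ≤ L) :
    Solved C k (tryGuesses.den (preparedMemory (inputMemory G C M k L))) := by
  obtain hn | hn := isEmpty_or_nonempty (Fin n)
  · exact ⟨M', hM', hk, fun u => hn.elim u⟩
  obtain ⟨D, hD⟩ := exists_ofColor_guessedEdges_eq hL
  refine solved_tryGuesses storesInput_preparedMemory hM (Fin.pos_iff_nonempty.2 hn)
    (preparedMemory_zero _ 3) (fun e => ?_) ⟨c, M', hM', hk, hD⟩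
  rw [preparedMemory_of_notMem (by decide)]
  rfl

end Enumeration

end ExactMatching

theorem mainTheorem4 :
    ∃ (P : RAM.Prog) (c : ℕ),
      ∀ (n : ℕ) (G : SimpleGraph (Fin n)) (C : G.EdgeLabeling ExactMatching.Color)
        (M : G.Subgraph) (_ : M.IsPerfectMatching) (k L : ℕ),
        ∃ (t : ℕ) (m : RAM.Memory),
          RAM.Runs P (ExactMatching.inputMemory G C M k L) t m ∧
          t ≤ (max n 2) ^ (c * max L 1) ∧
          ∀ M' : G.Subgraph, M'.IsPerfectMatching →
            ExactMatching.redCount C M' = k →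
            ((ExactMatching.ofColor C .blue (symmDiff M.edgeSet M'.edgeSet)).ncard ≤ L ∨
              (ExactMatching.ofColor C .red (symmDiff M.edgeSet M'.edgeSet)).ncard ≤ L) →
            ∃ M'' : G.Subgraph, M''.IsPerfectMatching ∧
              ExactMatching.redCount C M'' = ExactMatching.redCount C M' ∧
              ExactMatching.Outputs m M'' := by
  obtain ⟨c, hc⟩ := ExactMatching.exists_runs_algorithm
  refine ⟨ExactMatching.algorithm, c, fun n G C M hM k L => ?_⟩
  obtain ⟨t, hrun, ht⟩ := hc n G C M k L
  refine ⟨t, _, hrun, ht, fun M' hM' hk hL => ?_⟩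
  rw [hk]
  exact hL.elim (ExactMatching.solved_preparedMemory hM hM' hk)
    (ExactMatching.solved_preparedMemory hM hM' hk)
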